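/- Let $T^2=\mathbb{C}/\Lambda$ be a torus, $P\in T^2$ the class of $p\in\mathbb{C}$ and $M=T^2-\{P\}$. Let $\mathbb{R}^4_1$ carry the Lorentz product of signature $(+,+,+,-)$. A complete regular algebraic stationary surface $X:M\to\mathbb{R}^4_1$ is a map of the form $$X=2\,\mathrm{Re}\int\big(\phi+\psi,\,-i(\phi-\psi),\,1-\phi\psi,\,1+\phi\psi\big)\,dh ,$$ single-valued on $M$ (equivalently, the period conditions hold), where the Gauss maps $\phi,\psi:T^2\to\mathbb{C}\cup\{\infty\}$ are meromorphic functions and $dh$ is a meromorphic 1-form on $T^2$, such that $\phi\neq\overline{\psi}$ everywhere on $T^2$ as points of $\mathbb{C}\cup\{\infty\}$ (with $\overline\infty=\infty$; at $P$ this says that the end is regular), $dh$ is holomorphic on $M$ and its zeros on $M$ are exactly the poles on $M$ of $\phi$ or $\psi$, with the same orders, and the induced metric on $M$ is complete. Theorem. Let $X:T^2-\{P\}\to\mathbb{R}^4_1$ be a complete regular algebraic stationary surface with total curvature $-\int_M K\,dM=8\pi$ whose Gauss maps $\phi$ and $\psi$ both have order $2$ at $P$, that is, each takes its value at $P$ with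 multiplicity $2$. Then $X$ is not embedded. More precisely, let $I$ be the involution $z\mapsto 2p-z$ of $T^2$; in the coordinates $x=\wp(z-p)$, $y=\wp'(z-p)$, for which $P$ is the point at infinity of a Weierstrass cubic, it is $(x,y)\mapsto(x,-y)$. Then $I^*(X_z\,dz)=-X_z\,dz$ on $M$, the involution $I$ has exactly three fixed points on $M$, and $X$ maps these three points to one and the same point of $\mathbb{R}^4_1$. -/

import Mathlib

open scoped Topology

noncomputable section

namespace StationaryTorus

/-- The torus `ℂ / Λ`, where `Λ` is the lattice of a period pair. -/
abbrev Torus (L : PeriodPair) : Type := ℂ ⧸ L.lattice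

/-- The projection `ℂ → ℂ / Λ`. -/
def proj (L : PeriodPair) (z : ℂ) : Torus L := Submodule.Quotient.mk z

/-- The punctured torus `M = ℂ / Λ - {P}`, where `P` is the class of `p`. -/
def punctured (L : PeriodPair) (p : ℂ) : Set (Torus L) := {t | t ≠ proj L p}

/-- The involution `P + u ↦ P - u` of the torus, where `P` is the class of `p`. With `x = ℘(z - p)`
and `y = ℘'(z - p)` it is `(x, y) ↦ (x, -y)`, and `P` is the point at infinity of the cubic. -/
def involution (L : PeriodPair) (p : ℂ) (t : Torus L) : Torus L := proj L (2 * p) - t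

/-- The Lorentz product of `ℝ⁴₁`, of signature `(+,+,+,-)`. -/
def lorentz (u v : Fin 4 → ℝ) : ℝ := u 0 * v 0 + u 1 * v 1 + u 2 * v 2 - u 3 * v 3

/-! ### Meromorphic functions on the torus -/

/-- A meromorphic function on `ℂ / Λ`, given as a `Λ`-periodic meromorphic function on `ℂ`.
The normal form only fixes the values at individual points: `f` is analytic where it has no pole,
and a pole is given the placeholder value `0` (see `sphereValue` for the true value). -/
structure IsElliptic (L : PeriodPair) (f : ℂ → ℂ) : Prop where
  meromorphicNF : MeromorphicNFOn f Set.univ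
  periodic : ∀ l ∈ L.lattice, ∀ z, f (z + l) = f z

/-- The order of the pole of `f` at `z` (zero if there is no pole). -/
def poleOrder (f : ℂ → ℂ) (z : ℂ) : ℕ := (-(meromorphicOrderAt f z).untop₀).toNat

/-- The value in `ℂ ∪ {∞}` of a meromorphic function in normal form. -/
def sphereValue (f : ℂ → ℂ) (z : ℂ) : OnePoint ℂ :=
  open Classical in if meromorphicOrderAt f z < 0 then OnePoint.infty else ((f z : ℂ) : OnePoint ℂ)

/-- Complex conjugation on `ℂ ∪ {∞}`, with `∞` fixed. -/
def sphereConj (w : OnePoint ℂ) : OnePoint ℂ := OnePoint.map (starRingEnd ℂ) w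

/-- The multiplicity (order) with which a meromorphic function in normal form takes its value at
`z`: the order of the pole if the value is `∞`, and the order of the zero of `f - f z` otherwise
(`0` if `f` is constant). -/
def multiplicityAt (f : ℂ → ℂ) (z : ℂ) : ℕ :=
  open Classical in
  if meromorphicOrderAt f z < 0 then poleOrder f z
  else (meromorphicOrderAt (fun w => f w - f z) z).untop₀.toNat

/-! ### Surfaces in `ℝ⁴₁` defined on a punctured torus

A surface is a map `X` on the torus; its value at the puncture is never used. -/

/-- The lift of `X` to `ℂ`. -/
def lift {L : PeriodPair} (X : Torus L → Fin 4 → ℝ) (z : ℂ) : Fin 4 → ℝ := X (proj L z)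

/-- The coefficients of the `ℂ⁴`-valued 1-form `X_z dz`:
`X_z = (∂X/∂x - i ∂X/∂y) / 2` with `z = x + i y`. -/
def wirtinger {L : PeriodPair} (X : Torus L → Fin 4 → ℝ) (z : ℂ) (j : Fin 4) : ℂ :=
  (1 / 2) * ((fderiv ℝ (lift X) z 1 j : ℂ) - Complex.I * (fderiv ℝ (lift X) z Complex.I j : ℂ))

/-- The coefficients of the 1-form `(φ + ψ, -i (φ - ψ), 1 - φ ψ, 1 + φ ψ) dh`, where `dh = h dz`;
they are meromorphic functions of `z`, and removable singularities are removed. -/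
def weierstrassForm (φ ψ h : ℂ → ℂ) (z : ℂ) (j : Fin 4) : ℂ :=
  toMeromorphicNFOn (fun w => (![φ w + ψ w, -Complex.I * (φ w - ψ w),
    1 - φ w * ψ w, 1 + φ w * ψ w] : Fin 4 → ℂ) j * h w) Set.univ z

/-- The first fundamental form is `4 |φ - conj ψ|² |dh|²`: a surface given by the Weierstrass
representation is conformal and spacelike. Here `a`, `b`, `h` are the values of `φ`, `ψ`, `dh/dz`
at a point without poles. -/
theorem firstFundamentalForm {L : PeriodPair} (X : Torus L → Fin 4 → ℝ) (z a b h v : ℂ)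
    (H : ∀ j, wirtinger X z j =
      (![a + b, -Complex.I * (a - b), 1 - a * b, 1 + a * b] : Fin 4 → ℂ) j * h) :
    lorentz (fderiv ℝ (lift X) z v) (fderiv ℝ (lift X) z v) =
      4 * Complex.normSq (a - starRingEnd ℂ b) * Complex.normSq h * Complex.normSq v := by
  have hv : v = v.re • (1 : ℂ) + v.im • Complex.I := by
    apply Complex.ext <;> simp
  have e : fderiv ℝ (lift X) z v =
      v.re • fderiv ℝ (lift X) z 1 + v.im • fderiv ℝ (lift X) z Complex.I := by
    conv_lhs => rw [hv]
    rw [map_add, map_smul, map_smul]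
  have k : ∀ j, fderiv ℝ (lift X) z 1 j = 2 * (wirtinger X z j).re ∧
      fderiv ℝ (lift X) z Complex.I j = -2 * (wirtinger X z j).im := by
    intro j
    simp [wirtinger]
  rw [e]
  simp only [lorentz, Pi.add_apply, Pi.smul_apply, smul_eq_mul, (k _).1, (k _).2, H]
  simp [Complex.normSq_apply]
  ring

/-- The factor `E = ⟨∂X/∂x, ∂X/∂x⟩` of the induced metric. All surfaces considered here are
conformal by the Weierstrass representation, so the induced metric is `E (dx² + dy²)`. -/
def confFactor {L : PeriodPair} (X : Torus L → Fin 4 → ℝ) (z : ℂ) : ℝ :=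
  lorentz (fderiv ℝ (lift X) z 1) (fderiv ℝ (lift X) z 1)

/-- The Gaussian curvature `K = - Δ (log E) / (2 E)` of the metric `E (dx² + dy²)`. -/
def gaussCurvature {L : PeriodPair} (X : Torus L → Fin 4 → ℝ) (z : ℂ) : ℝ :=
  -(Laplacian.laplacian (fun w => Real.log (confFactor X w)) z) / (2 * confFactor X z)

/-- The total curvature `∫_M K dM`, with `dM = E dx dy`, computed on a fundamental parallelogram
of the lattice (the puncture has measure zero). -/
def totalCurvature {L : PeriodPair} (X : Torus L → Fin 4 → ℝ) : ℝ :=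
  ∫ z in ZSpan.fundamentalDomain L.basis, gaussCurvature X z * confFactor X z

/-- Completeness of the induced metric: each `C¹` path in the punctured torus that leaves every
compact subset of it, i.e. that tends to the puncture, has infinite length. Paths are given by
their lifts to `ℂ`. -/
def IsCompleteSurface {L : PeriodPair} (p : ℂ) (X : Torus L → Fin 4 → ℝ) : Prop :=
  ∀ γ : ℝ → ℂ, ContDiff ℝ 1 γ → (∀ t, 0 ≤ t → proj L (γ t) ∈ punctured L p) →
    Filter.Tendsto (fun t => proj L (γ t)) Filter.atTop (𝓝 (proj L p)) →
    ∫⁻ t in Set.Ici (0 : ℝ), ENNReal.ofReal (Real.sqrt (lorentz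
      (fderiv ℝ (lift X) (γ t) (deriv γ t)) (fderiv ℝ (lift X) (γ t) (deriv γ t)))) = ⊤

/-- `X` is a complete regular algebraic stationary surface on the torus punctured at the class of
`p`, with Gauss maps `φ`, `ψ` and height differential `dh = h dz`. The period conditions are
contained in the requirement that `X` is a (single-valued) function on the punctured torus. -/
structure IsCompleteRegularAlgebraic (L : PeriodPair) (p : ℂ) (φ ψ h : ℂ → ℂ)
    (X : Torus L → Fin 4 → ℝ) : Prop where
  elliptic_left : IsElliptic L φ
  elliptic_right : IsElliptic L ψ
  elliptic_height : IsElliptic L h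
  /-- `φ ≠ conj ψ` everywhere, as points of `ℂ ∪ {∞}`. At points of `M` this is the regularity of
  the surface, which includes that the poles of `φ` and `ψ` do not coincide; at the puncture it
  says that the end is regular. -/
  regular : ∀ z, sphereValue φ z ≠ sphereConj (sphereValue ψ z)
  /-- On `M`, `dh` is holomorphic and its zeros are the poles of `φ` or `ψ`, with the same
  order. -/
  zeros_height : ∀ z, proj L z ∈ punctured L p →
    meromorphicOrderAt h z = (((poleOrder φ z + poleOrder ψ z : ℕ) : ℤ) : WithTop ℤ)
  differentiable : ∀ z, proj L z ∈ punctured L p → DifferentiableAt ℝ (lift X) z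
  /-- `X = 2 Re ∫ (φ + ψ, -i (φ - ψ), 1 - φ ψ, 1 + φ ψ) dh`, in differential form. -/
  representation : ∀ z, proj L z ∈ punctured L p → wirtinger X z = weierstrassForm φ ψ h z
  complete : IsCompleteSurface p X

/-- The surface is embedded: `X` is a homeomorphism of the punctured torus onto its image. -/
def IsEmbeddedSurface {L : PeriodPair} (p : ℂ) (X : Torus L → Fin 4 → ℝ) : Prop :=
  Topology.IsEmbedding ((punctured L p).domRestrict X)

end StationaryTorus

end

/-!
The surface is conformal, with conformal factor `E = 4 |φ - conj ψ|² |h|²`, where `dh = h dz`, and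
`K E = - Δ (log E) / 2`. As `φ ≠ conj ψ` in the sphere and the zeros of `h` cancel the poles of `φ`
and `ψ`, the function `log E` is smooth on the punctured torus, and it equals `2 e log |z - p|` plus
a smooth function near the puncture, with `e = ord h - (pole order of φ) - (pole order of ψ)` at
`p`. On the torus the distributional Laplacian has total integral zero, and `log |z - p|`
contributes a mass `2π`, so `∫ K dM = 2π e` (`totalCurvature_eq`, from
`integral_laplacian_of_log_singularity`). Total curvature `-8π` therefore means `e = -4`.

The degrees of `φ` and `ψ` need not be counted. If both are finite at `p`, then `h` has a pole of
order four there, and since both values are taken twice, `(φ - φ p) h` and `(ψ - ψ p) h` have no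
pole but one of order two at `p`, while `(φ - φ p) (ψ - ψ p) h` has neither pole nor zero at `p` and
is a nonzero constant. An elliptic function whose only pole is at `p` and of order at most two is
even about `p` (`even_of_order_ge_neg_two`): its odd part has at most a simple pole, and such a
function vanishes. Dividing by the constant shows that `h`, `φ h`, `ψ h` and `φ ψ h` are even. If `φ`
or `ψ` has a pole at `p`, the argument is the same with other products (`even_of_pole`). No residue
theorem is needed.

Hence the coefficients of `X_z dz` are even about `p`, the form itself is odd under the involution,
and `X (z) + X (2p - z)` is constant on the punctured torus. At a fixed point this sum is `2 X`, so
`X` takes the same value at the three fixed points, the nonzero half periods from `p`.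
-/

namespace StationaryTorus

open MeasureTheory Filter

/-! ### Integrals over a fundamental parallelogram -/

/-- The fundamental parallelogram of the lattice. -/
abbrev cell (L : PeriodPair) : Set ℂ := ZSpan.fundamentalDomain L.basis

lemma isAddFundamentalDomain_cell (L : PeriodPair) :
    IsAddFundamentalDomain (Submodule.span ℤ (Set.range L.basis)).toAddSubgroup (cell L)
      volume :=
  ZSpan.isAddFundamentalDomain' L.basis volume

open scoped Pointwise in
lemma isAddFundamentalDomain_vadd_cell (L : PeriodPair) (a : ℂ) :
    IsAddFundamentalDomain (Submodule.span ℤ (Set.range L.basis)).toAddSubgroup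
      (a +ᵥ cell L) volume :=
  (isAddFundamentalDomain_cell L).vadd_of_comm a

/-- Invariance under translation by the lattice. It is imposed at every point, also where a
meromorphic function has a pole, as in `IsElliptic`. -/
def Periodic {E : Type*} (L : PeriodPair) (f : ℂ → E) : Prop :=
  ∀ l ∈ L.lattice, ∀ z, f (z + l) = f z

open scoped Pointwise in
lemma setIntegral_vadd_cell {L : PeriodPair} {f : ℂ → ℝ} (hf : Periodic L f) (a : ℂ) :
    ∫ z in a +ᵥ cell L, f z = ∫ z in cell L, f z := by
  have : Countable (Submodule.span ℤ (Set.range L.basis)).toAddSubgroup :=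
    inferInstanceAs (Countable (Submodule.span ℤ (Set.range L.basis)))
  refine (isAddFundamentalDomain_vadd_cell L a).setIntegral_eq (isAddFundamentalDomain_cell L) ?_
  intro g x
  have h : (g : ℂ) ∈ L.lattice := by
    rw [L.lattice_eq_span_range_basis]; exact g.2
  have := hf g h x
  rw [add_comm] at this
  exact this

open scoped Pointwise in
lemma setIntegral_comp_add {L : PeriodPair} {f : ℂ → ℝ} (hf : Periodic L f) (a : ℂ) :
    ∫ z in cell L, f (z + a) = ∫ z in cell L, f z := by
  rw [← setIntegral_vadd_cell hf a]
  have h := (measurePreserving_add_right (volume : Measure ℂ) a).setIntegral_image_emb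
    (measurableEmbedding_addRight a) f (cell L)
  rw [← h]
  have e : a +ᵥ cell L = (fun x => x + a) '' cell L :=
    Set.image_congr fun z _ => by rw [vadd_eq_add, add_comm]
  rw [e]

lemma exists_sub_mem_cell (L : PeriodPair) (z : ℂ) : ∃ l ∈ L.lattice, z - l ∈ cell L := by
  refine ⟨ZSpan.floor L.basis z, ?_, ?_⟩
  · rw [L.lattice_eq_span_range_basis]; exact Subtype.mem _
  · exact ZSpan.fract_mem_fundamentalDomain L.basis z

lemma isBounded_cell (L : PeriodPair) : Bornology.IsBounded (cell L) :=
  ZSpan.fundamentalDomain_isBounded L.basis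

lemma measurableSet_cell (L : PeriodPair) : MeasurableSet (cell L) :=
  ZSpan.fundamentalDomain_measurableSet L.basis

lemma volume_cell_lt_top (L : PeriodPair) : volume (cell L) < ⊤ :=
  (isBounded_cell L).measure_lt_top

/-- A continuous function on the torus is bounded. -/
lemma Periodic.exists_bound {E : Type*} [NormedAddCommGroup E] {L : PeriodPair} {f : ℂ → E}
    (hf : Periodic L f) (hc : Continuous f) : ∃ C, ∀ z, ‖f z‖ ≤ C := by
  obtain ⟨C, hC⟩ := (isBounded_cell L).isCompact_closure.exists_bound_of_continuousOn
    hc.continuousOn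
  refine ⟨C, fun z => ?_⟩
  obtain ⟨l, hl, hz⟩ := exists_sub_mem_cell L z
  have := hf l hl (z - l)
  rw [sub_add_cancel] at this
  rw [this]
  exact hC _ (subset_closure hz)

lemma integrableOn_cell_of_continuous {E : Type*} [NormedAddCommGroup E] (L : PeriodPair)
    {f : ℂ → E} (hc : Continuous f) : IntegrableOn f (cell L) :=
  (hc.continuousOn.integrableOn_compact (isBounded_cell L).isCompact_closure).mono_set
    subset_closure

lemma Periodic.fderiv {E : Type*} [NormedAddCommGroup E] [NormedSpace ℝ E] {L : PeriodPair}
    {f : ℂ → E} (hf : Periodic L f) : Periodic L (fderiv ℝ f) := by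
  intro l hl z
  rw [← fderiv_comp_add_right]
  congr 1
  ext w
  exact hf l hl w

/-- The directional derivative of a `C¹` function on the torus has integral zero: the integral of
`f (z + t v)` over a fundamental parallelogram does not depend on `t`. -/
lemma setIntegral_fderiv_eq_zero {L : PeriodPair} {f : ℂ → ℝ} (hf : Periodic L f)
    (hc : ContDiff ℝ 1 f) (v : ℂ) : ∫ z in cell L, fderiv ℝ f z v = 0 := by
  have hcd : Continuous (fun z => fderiv ℝ f z v) :=
    (hc.continuous_fderiv one_ne_zero).clm_apply continuous_const
  obtain ⟨C, hC⟩ := Periodic.exists_bound (L := L) (f := fun z => _root_.fderiv ℝ f z v)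
    (fun l hl z => by simp only [hf.fderiv l hl z]) hcd
  have key := hasDerivAt_integral_of_dominated_loc_of_deriv_le (μ := volume.restrict (cell L))
    (F := fun (t : ℝ) z => f (z + t • v)) (F' := fun t z => fderiv ℝ f (z + t • v) v)
    (bound := fun _ => C) (x₀ := (0 : ℝ)) (s := Set.univ) univ_mem
    (Eventually.of_forall fun t => by
      have := hc.continuous
      exact (by fun_prop : Continuous fun z => f (z + t • v)).aestronglyMeasurable)
    (by simpa [IntegrableOn] using integrableOn_cell_of_continuous L hc.continuous)
    (by simpa using hcd.aestronglyMeasurable)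
    (Eventually.of_forall fun z t _ => hC _)
    (integrableOn_const (volume_cell_lt_top L).ne)
    (Eventually.of_forall fun z t _ => by
      have h1 : HasDerivAt (fun t : ℝ => z + t • v) v t := by
        simpa using ((hasDerivAt_id t).smul_const v).const_add z
      exact ((hc.differentiable one_ne_zero _).hasFDerivAt).comp_hasDerivAt t h1)
  have h2 := key.2
  simp only [setIntegral_comp_add hf] at h2
  simpa using h2.unique (hasDerivAt_const _ _)

lemma laplacian_eq_fderiv_fderiv (f : ℂ → ℝ) (z : ℂ) :
    Laplacian.laplacian f z = fderiv ℝ (fderiv ℝ f) z 1 1 +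
      fderiv ℝ (fderiv ℝ f) z Complex.I Complex.I := by
  rw [congrFun (InnerProductSpace.laplacian_eq_iteratedFDeriv_complexPlane f) z]
  simp [iteratedFDeriv_two_apply]

lemma fderiv_fderiv_apply {f : ℂ → ℝ} (hc : ContDiff ℝ 2 f) (z v : ℂ) :
    fderiv ℝ (fderiv ℝ f) z v v = fderiv ℝ (fun w => fderiv ℝ f w v) z v := by
  have : DifferentiableAt ℝ (fderiv ℝ f) z :=
    (hc.fderiv_right (m := 1) (by norm_num)).differentiable one_ne_zero z
  rw [fderiv_clm_apply this (differentiableAt_const v)]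
  simp

lemma continuous_laplacian {f : ℂ → ℝ} (hc : ContDiff ℝ 2 f) :
    Continuous (Laplacian.laplacian f) := by
  have h : Continuous (fderiv ℝ (fderiv ℝ f)) :=
    (hc.fderiv_right (m := 1) (by norm_num)).continuous_fderiv one_ne_zero
  have e : Laplacian.laplacian f = fun z => fderiv ℝ (fderiv ℝ f) z 1 1 +
      fderiv ℝ (fderiv ℝ f) z Complex.I Complex.I := funext (laplacian_eq_fderiv_fderiv f)
  rw [e]
  fun_prop

lemma setIntegral_laplacian_eq_zero {L : PeriodPair} {f : ℂ → ℝ} (hf : Periodic L f)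
    (hc : ContDiff ℝ 2 f) : ∫ z in cell L, Laplacian.laplacian f z = 0 := by
  have hd : ∀ v, ContDiff ℝ 1 (fun w => fderiv ℝ f w v) := fun v =>
    (hc.fderiv_right (m := 1) (by norm_num)).clm_apply contDiff_const
  have hp : ∀ v, Periodic L (fun w => _root_.fderiv ℝ f w v) := fun v l hl z => by
    simp only [hf.fderiv l hl z]
  have hi : ∀ v, IntegrableOn (fun z => fderiv ℝ (fun w => fderiv ℝ f w v) z v) (cell L) :=
    fun v => integrableOn_cell_of_continuous L
      (((hd v).continuous_fderiv one_ne_zero).clm_apply continuous_const)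
  simp_rw [laplacian_eq_fderiv_fderiv, fderiv_fderiv_apply hc]
  rw [integral_add (hi 1) (hi _), setIntegral_fderiv_eq_zero (hp 1) (hd 1),
    setIntegral_fderiv_eq_zero (hp _) (hd _), add_zero]

/-! ### Functions regular off isolated points -/

lemma mem_codiscrete_of_eventually {P : ℂ → Prop} (h : ∀ z, ∀ᶠ w in 𝓝[≠] z, P w) :
    {w | P w} ∈ codiscrete ℂ := by
  rw [mem_codiscrete]
  intro z
  rw [disjoint_principal_right, compl_compl]
  exact h z

lemma ae_of_eventually_nhdsNE {P : ℂ → Prop} (h : ∀ z, ∀ᶠ w in 𝓝[≠] z, P w) :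
    ∀ᵐ w : ℂ, P w := by
  have := ae_restrict_le_codiscreteWithin (μ := (volume : Measure ℂ)) MeasurableSet.univ
    (mem_codiscrete_of_eventually h)
  rw [Measure.restrict_univ] at this
  exact this

/-- If a property holds near `z`, except possibly at `z`, then at the points near `z` other than `z`
it holds on a full neighbourhood. -/
lemma eventually_nhdsNE_eventually_nhds {P : ℂ → Prop} {z : ℂ} (h : ∀ᶠ w in 𝓝[≠] z, P w) :
    ∀ᶠ w in 𝓝[≠] z, ∀ᶠ v in 𝓝 w, P v := by
  filter_upwards [eventually_eventually_nhdsWithin.mpr h, self_mem_nhdsWithin] with w hw hz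
  rwa [IsOpen.nhdsWithin_eq isOpen_compl_singleton hz] at hw

lemma eventually_nhds_eventually_nhdsNE {P : ℂ → Prop} {z : ℂ} (h : ∀ᶠ w in 𝓝[≠] z, P w) :
    ∀ᶠ w in 𝓝 z, ∀ᶠ v in 𝓝[≠] w, P v := by
  have h1 := eventually_nhdsWithin_iff.mp (eventually_nhdsNE_eventually_nhds h)
  filter_upwards [h1] with w hw
  by_cases e : w = z
  · rwa [e]
  · exact (hw e).filter_mono nhdsWithin_le_nhds

lemma tendsto_nhdsNE_of_injective {g : ℂ → ℂ} (hg : Continuous g) (hi : Function.Injective g)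
    (z : ℂ) : Tendsto g (𝓝[≠] z) (𝓝[≠] (g z)) := by
  refine tendsto_nhdsWithin_iff.mpr ⟨hg.continuousAt.tendsto.mono_left nhdsWithin_le_nhds, ?_⟩
  filter_upwards [self_mem_nhdsWithin] with w hw e
  exact hw (hi e)

/-- A periodic function that is `C²` up to changing its values at isolated points agrees, off
isolated points, with a periodic `C²` function. -/
lemma exists_contDiff_of_eventuallyEq {L : PeriodPair} {U : ℂ → ℝ} (hU : Periodic L U)
    (h : ∀ z, ∃ s : ℂ → ℝ, ContDiffAt ℝ 2 s z ∧ U =ᶠ[𝓝[≠] z] s) :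
    ∃ w : ℂ → ℝ, ContDiff ℝ 2 w ∧ Periodic L w ∧ ∀ z, U =ᶠ[𝓝[≠] z] w := by
  have key : ∀ z, ∀ s : ℂ → ℝ, ContDiffAt ℝ 2 s z → U =ᶠ[𝓝[≠] z] s →
      (fun v => limUnder (𝓝[≠] v) U) =ᶠ[𝓝 z] s := by
    intro z s hs hUs
    filter_upwards [hs.eventually (by simp), eventually_nhds_eventually_nhdsNE hUs] with v h1 h2
    refine Tendsto.limUnder_eq ?_
    exact ((h1.continuousAt.tendsto).mono_left nhdsWithin_le_nhds).congr' (h2.mono fun _ h => h.symm)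
  -- The limit at each point repairs the values at the isolated points.
  refine ⟨fun v => limUnder (𝓝[≠] v) U, ?_, ?_, ?_⟩
  · rw [contDiff_iff_contDiffAt]
    intro z
    obtain ⟨s, hs, hUs⟩ := h z
    exact hs.congr_of_eventuallyEq (key z s hs hUs)
  · intro l hl z
    obtain ⟨s, hs, hUs⟩ := h z
    have t1 : Tendsto U (𝓝[≠] z) (𝓝 (s z)) :=
      ((hs.continuousAt.tendsto).mono_left nhdsWithin_le_nhds).congr' (hUs.mono fun _ h => h.symm)
    have t2 : Tendsto U (𝓝[≠] (z + l)) (𝓝 (s z)) := by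
      have hm := tendsto_nhdsNE_of_injective (continuous_sub_right l) sub_left_injective (z + l)
      rw [add_sub_cancel_right] at hm
      refine (t1.comp hm).congr fun w => ?_
      have := hU l hl (w - l)
      rw [sub_add_cancel] at this
      exact this.symm
    simp only
    rw [t1.limUnder_eq, t2.limUnder_eq]
  · intro z
    obtain ⟨s, hs, hUs⟩ := h z
    exact hUs.trans ((key z s hs hUs).filter_mono nhdsWithin_le_nhds).symm

lemma laplacian_congr_of_eventuallyEq {f g : ℂ → ℝ} {z : ℂ} (h : f =ᶠ[𝓝[≠] z] g) :
    Laplacian.laplacian f =ᶠ[𝓝[≠] z] Laplacian.laplacian g := by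
  filter_upwards [eventually_nhdsNE_eventually_nhds h] with w hw
  exact (InnerProductSpace.laplacian_congr_nhds hw).eq_of_nhds

/-- Values at isolated points affect neither the Laplacian elsewhere nor its integral. The
integrability is needed to split integrals, as the integral of a non-integrable function is `0`. -/
lemma integral_laplacian_of_removable {L : PeriodPair} {U : ℂ → ℝ} (hU : Periodic L U)
    (h : ∀ z, ∃ s : ℂ → ℝ, ContDiffAt ℝ 2 s z ∧ U =ᶠ[𝓝[≠] z] s) :
    (∀ B, Bornology.IsBounded B → IntegrableOn (Laplacian.laplacian U) B) ∧
      ∫ z in cell L, Laplacian.laplacian U z = 0 := by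
  obtain ⟨w, hw, hp, hUw⟩ := exists_contDiff_of_eventuallyEq hU h
  have hae : Laplacian.laplacian U =ᵐ[volume] Laplacian.laplacian w :=
    ae_of_eventually_nhdsNE fun z => laplacian_congr_of_eventuallyEq (hUw z)
  constructor
  · intro B hB
    exact (((continuous_laplacian hw).continuousOn.integrableOn_compact
      hB.isCompact_closure).mono_set subset_closure).congr_fun_ae
      (ae_restrict_of_ae hae.symm)
  · rw [integral_congr_ae (ae_restrict_of_ae hae), setIntegral_laplacian_eq_zero hp hw]

/-! ### A cut-off logarithm -/

lemma contDiffAt_deriv {θ : ℝ → ℝ} {t : ℝ} {n : ℕ} (h : ContDiffAt ℝ (n + 1) θ t) :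
    ContDiffAt ℝ n (deriv θ) t := by
  have h := h.fderiv_right (m := n) le_rfl
  have e : deriv θ = fun t => fderiv ℝ θ t 1 := by ext t; simp
  rw [e]
  exact h.clm_apply contDiffAt_const

lemma contDiff_normSq : ContDiff ℝ 2 (fun z : ℂ => (Complex.normSq z : ℝ)) := by
  have e : (fun z : ℂ => (Complex.normSq z : ℝ)) = fun z => z.re * z.re + z.im * z.im := by
    ext z; exact Complex.normSq_apply z
  rw [e]
  have hr : ContDiff ℝ 2 (fun z : ℂ => z.re) := Complex.reCLM.contDiff
  have hi : ContDiff ℝ 2 (fun z : ℂ => z.im) := Complex.imCLM.contDiff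
  exact (hr.mul hr).add (hi.mul hi)

/-- The Laplacian of the radial function `θ (|z|²)` is `4 (t θ')' (|z|²)`. -/
lemma laplacian_comp_normSq {θ : ℝ → ℝ} {z : ℂ} (hθ : ContDiffAt ℝ 2 θ (Complex.normSq z)) :
    Laplacian.laplacian (fun w => θ (Complex.normSq w)) z =
      4 * deriv (fun t => t * deriv θ t) (Complex.normSq z) := by
  have hN : ∀ w : ℂ, HasFDerivAt (fun w : ℂ => (Complex.normSq w : ℝ))
      ((2 * w.re) • Complex.reCLM + (2 * w.im) • Complex.imCLM) w := by
    intro w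
    have h1 : HasFDerivAt (fun w : ℂ => w.re) Complex.reCLM w := Complex.reCLM.hasFDerivAt
    have h2 : HasFDerivAt (fun w : ℂ => w.im) Complex.imCLM w := Complex.imCLM.hasFDerivAt
    have := (h1.mul h1).add (h2.mul h2)
    refine (this.congr_of_eventuallyEq (Eventually.of_forall fun x => ?_)).congr_fderiv ?_
    · simp [Complex.normSq_apply]
    · ext <;> (simp; ring)
  have hc : Continuous (fun w : ℂ => (Complex.normSq w : ℝ)) := Complex.continuous_normSq
  have hev : ∀ᶠ w in 𝓝 z, ContDiffAt ℝ 2 θ (Complex.normSq w) :=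
    hc.continuousAt.eventually (hθ.eventually (by simp))
  have hd1 : ∀ᶠ w in 𝓝 z, fderiv ℝ (fun w => θ (Complex.normSq w)) w =
      deriv θ (Complex.normSq w) • ((2 * w.re) • Complex.reCLM + (2 * w.im) • Complex.imCLM) := by
    filter_upwards [hev] with w hw
    have := (hw.differentiableAt (by norm_num)).hasDerivAt.comp_hasFDerivAt w (hN w)
    exact this.fderiv
  have hθ' : HasDerivAt (deriv θ) (deriv (deriv θ) (Complex.normSq z)) (Complex.normSq z) := by
    exact ((contDiffAt_deriv (n := 1) (by exact_mod_cast hθ)).differentiableAt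
      one_ne_zero).hasDerivAt
  have hd2 : HasFDerivAt (fderiv ℝ (fun w => θ (Complex.normSq w)))
      (deriv θ (Complex.normSq z) • ((2 : ℝ) • Complex.reCLM.smulRight Complex.reCLM +
          (2 : ℝ) • Complex.imCLM.smulRight Complex.imCLM) +
        (deriv (deriv θ) (Complex.normSq z) •
          ((2 * z.re) • Complex.reCLM + (2 * z.im) • Complex.imCLM)).smulRight
          ((2 * z.re) • Complex.reCLM + (2 * z.im) • Complex.imCLM)) z := by
    refine HasFDerivAt.congr_of_eventuallyEq ?_ hd1
    have h1 : HasFDerivAt (fun w : ℂ => w.re) Complex.reCLM z := Complex.reCLM.hasFDerivAt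
    have h2 : HasFDerivAt (fun w : ℂ => w.im) Complex.imCLM z := Complex.imCLM.hasFDerivAt
    have hA := ((h1.const_mul 2).smul_const Complex.reCLM).add
      ((h2.const_mul 2).smul_const Complex.imCLM)
    have := (hθ'.comp_hasFDerivAt z (hN z)).smul hA
    refine this.congr_fderiv ?_
    ext
    simp
    ring
  have hk : deriv (fun t => t * deriv θ t) (Complex.normSq z) =
      deriv θ (Complex.normSq z) + Complex.normSq z * deriv (deriv θ) (Complex.normSq z) := by
    have := (hasDerivAt_id (Complex.normSq z)).mul hθ'
    have h := this.deriv
    simp only [id, one_mul] at h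
    exact h
  rw [laplacian_eq_fderiv_fderiv, hd2.fderiv, hk]
  simp [Complex.normSq_apply]
  ring

/-- A radial profile equal to `log t / 2` for small `t` and to `0` for large `t`. As `t = |z|²`, it
is the profile of a cut-off of `log |z|`. -/
lemma exists_log_profile {a : ℝ} (ha : 0 < a) : ∃ θ : ℝ → ℝ,
    (∀ t, 0 < t → ContDiffAt ℝ 2 θ t) ∧ (∀ t, t < a → θ t = Real.log t / 2) ∧
    ∀ t, 2 * a < t → θ t = 0 := by
  refine ⟨fun t => (1 - Real.smoothTransition ((t - a) / a)) * (Real.log t / 2), ?_, ?_, ?_⟩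
  · intro t ht
    have h1 : ContDiff ℝ 2 (fun t : ℝ => 1 - Real.smoothTransition ((t - a) / a)) :=
      contDiff_const.sub (Real.smoothTransition.contDiff.comp
        ((contDiff_id.sub contDiff_const).div_const a))
    exact h1.contDiffAt.mul ((Real.contDiffAt_log.mpr ht.ne').div_const 2)
  · intro t ht
    simp only
    rw [Real.smoothTransition.zero_of_nonpos, sub_zero, one_mul]
    exact div_nonpos_of_nonpos_of_nonneg (by linarith) ha.le
  · intro t ht
    simp only
    rw [Real.smoothTransition.one_of_one_le, sub_self, zero_mul]
    rw [le_div_iff₀ ha]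
    linarith

/-- The Laplacian, off the origin, of a cut-off of `log |z|` is integrable with integral `-2π`:
the Laplacian of `log |z|` as a distribution is `2π δ`, and the total integral is zero. -/
lemma integral_laplacian_log_profile {a : ℝ} (ha : 0 < a) {θ : ℝ → ℝ}
    (h1 : ∀ t, 0 < t → ContDiffAt ℝ 2 θ t) (h2 : ∀ t, t < a → θ t = Real.log t / 2)
    (h3 : ∀ t, 2 * a < t → θ t = 0) :
    Integrable (Laplacian.laplacian (fun z : ℂ => θ (Complex.normSq z))) ∧
      ∫ z, Laplacian.laplacian (fun z : ℂ => θ (Complex.normSq z)) z = -(2 * Real.pi) := by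
  -- `κ (r²)` is half of `r` times the radial derivative, so the integrand in polar coordinates is
  -- the derivative of `2 κ (r²)`, which falls from `1` to `0`.
  set κ : ℝ → ℝ := fun t => t * deriv θ t with hκ
  have hθ' : ∀ t, 0 < t → ContDiffAt ℝ 1 (deriv θ) t := fun t ht =>
    contDiffAt_deriv (n := 1) (by exact_mod_cast h1 t ht)
  have hκc : ∀ t, 0 < t → ContDiffAt ℝ 1 κ t := fun t ht => contDiffAt_id.mul (hθ' t ht)
  have hκ0 : ∀ t, 0 < t → t < a → κ t = 1 / 2 := by
    intro t ht hta
    have : θ =ᶠ[𝓝 t] fun t => Real.log t / 2 := by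
      filter_upwards [Iio_mem_nhds hta] with s hs using h2 s hs
    simp only [hκ]
    rw [this.deriv_eq, deriv_div_const, Real.deriv_log]
    field_simp
  have hκ1 : ∀ t, 2 * a < t → κ t = 0 := by
    intro t hta
    have : θ =ᶠ[𝓝 t] fun _ => 0 := by
      filter_upwards [Ioi_mem_nhds hta] with s hs using h3 s hs
    simp only [hκ]
    rw [this.deriv_eq]
    simp
  have hκ'0 : ∀ t, 0 < t → t < a → deriv κ t = 0 := by
    intro t ht hta
    have : κ =ᶠ[𝓝 t] fun _ => 1 / 2 := by
      filter_upwards [Iio_mem_nhds hta, Ioi_mem_nhds ht] with s hs hs' using hκ0 s hs' hs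
    rw [this.deriv_eq]
    simp
  have hκ'1 : ∀ t, 2 * a < t → deriv κ t = 0 := by
    intro t hta
    have : κ =ᶠ[𝓝 t] fun _ => 0 := by
      filter_upwards [Ioi_mem_nhds hta] with s hs using hκ1 s hs
    rw [this.deriv_eq]
    simp
  have hκ'c : ContinuousOn (deriv κ) (Set.Ioi 0) := fun t ht =>
    (contDiffAt_deriv (n := 0) (by simpa using hκc t ht)).continuousAt.continuousWithinAt
  set F : ℝ → ℝ := fun r => 4 * deriv κ (r ^ 2) with hF
  have hae : Laplacian.laplacian (fun z : ℂ => θ (Complex.normSq z)) =ᵐ[volume]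
      fun z => F ‖z‖ := by
    have : ∀ᵐ z : ℂ, z ≠ 0 := by
      rw [ae_iff]
      simp
    filter_upwards [this] with z hz
    rw [laplacian_comp_normSq (h1 _ (Complex.normSq_pos.mpr hz)), hF]
    simp only [Complex.normSq_eq_norm_sq, hκ]
  have hint : IntegrableOn (fun y => y ^ (Module.finrank ℝ ℂ - 1) • F y) (Set.Ioi 0) := by
    have hc : ContinuousOn (fun y => y ^ (Module.finrank ℝ ℂ - 1) • F y)
        (Set.Icc (Real.sqrt (a / 2)) (Real.sqrt (3 * a))) := by
      refine (continuous_pow _).continuousOn.smul (continuousOn_const.mul ?_)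
      refine hκ'c.comp (continuous_pow 2).continuousOn ?_
      intro y hy
      have : 0 < y := lt_of_lt_of_le (Real.sqrt_pos.mpr (by linarith)) hy.1
      exact pow_pos this 2
    refine (hc.integrableOn_compact isCompact_Icc).of_forall_sdiff_eq_zero measurableSet_Ioi ?_
    intro y hy
    have hy0 : 0 < y := hy.1
    have : F y = 0 := by
      simp only [hF]
      by_cases h : y < Real.sqrt (a / 2)
      · rw [Real.lt_sqrt hy0.le] at h
        rw [hκ'0 _ (by positivity) (by linarith), mul_zero]
      · have h' : Real.sqrt (3 * a) < y := by
          by_contra hh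
          exact hy.2 ⟨not_lt.mp h, not_lt.mp hh⟩
        rw [Real.sqrt_lt' hy0] at h'
        rw [hκ'1 _ (by linarith), mul_zero]
    simp [this]
  constructor
  · rw [integrable_congr hae]
    exact (integrable_fun_norm_addHaar volume).mpr hint
  rw [integral_congr_ae hae, integral_fun_norm_addHaar]
  have hfin : Module.finrank ℝ ℂ = 2 := Complex.finrank_real_complex
  rw [hfin] at hint ⊢
  have hI : ∫ y in Set.Ioi (0 : ℝ), y ^ (2 - 1) • F y = 0 - 1 := by
    -- `κ 0 = 0`, so the value at `0` is adjusted to have a continuous primitive.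
    set f : ℝ → ℝ := fun r => if r ≤ 0 then 1 else 2 * κ (r ^ 2) with hf
    have hfp : ∀ r, 0 < r → f =ᶠ[𝓝 r] fun r => 2 * κ (r ^ 2) := by
      intro r hr
      filter_upwards [Ioi_mem_nhds hr] with s hs
      simp only [hf, if_neg (not_le.mpr (Set.mem_Ioi.mp hs))]
    have h0 : f 0 = 1 := by simp [hf]
    rw [← h0]
    refine integral_Ioi_of_hasDerivAt_of_tendsto (f := f) ?_ ?_ hint ?_
    · have : f =ᶠ[𝓝[Set.Ici 0] 0] fun _ => f 0 := by
        have : Set.Iio (Real.sqrt a) ∈ 𝓝[Set.Ici 0] (0 : ℝ) :=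
          mem_nhdsWithin_of_mem_nhds (Iio_mem_nhds (Real.sqrt_pos.mpr ha))
        filter_upwards [this] with s hs
        rw [h0]
        simp only [hf]
        split_ifs with h
        · rfl
        · rw [hκ0 (s ^ 2) (pow_pos (not_le.mp h) 2) ((Real.lt_sqrt (by linarith)).mp hs)]
          norm_num
      exact continuousWithinAt_const.congr_of_eventuallyEq this rfl
    · intro r hr
      have hr0 : 0 < r := hr
      have hd : HasDerivAt κ (deriv κ (r ^ 2)) (r ^ 2) :=
        ((hκc (r ^ 2) (by positivity)).differentiableAt one_ne_zero).hasDerivAt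
      have := ((HasDerivAt.comp (h := fun r : ℝ => r ^ 2) r hd (hasDerivAt_pow 2 r)).const_mul 2)
      refine (this.congr_of_eventuallyEq (hfp r hr0)).congr_deriv ?_
      simp only [hF, smul_eq_mul]
      push_cast
      ring
    · have : f =ᶠ[atTop] fun _ => 0 := by
        filter_upwards [eventually_gt_atTop (Real.sqrt (2 * a)), eventually_gt_atTop 0] with s hs h0
        simp only [hf, if_neg (not_le.mpr h0)]
        rw [hκ1 _ ((Real.sqrt_lt' h0).mp hs), mul_zero]
      exact tendsto_const_nhds.congr' this.symm
  rw [hI]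
  have hv : volume.real (Metric.ball (0 : ℂ) 1) = Real.pi := by
    simp [Measure.real]
  rw [hv]
  simp

/-! ### Logarithmic singularities on the torus -/

open scoped Pointwise in
lemma eq_zero_of_mem_vadd_cell {L : PeriodPair} {a z l : ℂ} (hl : l ∈ L.lattice)
    (h1 : z ∈ a +ᵥ cell L) (h2 : z - l ∈ a +ᵥ cell L) : l = 0 := by
  obtain ⟨u, hu, rfl⟩ := h1
  obtain ⟨v, hv, hv'⟩ := h2
  simp only [vadd_eq_add] at hv'
  have e : l = -v + u := by linear_combination hv'
  have h := (ZSpan.fract_eq_fract L.basis v u).mpr (by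
    rw [← L.lattice_eq_span_range_basis, ← e]; exact hl)
  rw [ZSpan.fract_eq_self.mpr hu, ZSpan.fract_eq_self.mpr hv] at h
  rw [e, h]
  ring

open scoped Pointwise in
lemma exists_sub_mem_vadd_cell (L : PeriodPair) (a z : ℂ) :
    ∃ l ∈ L.lattice, z - l ∈ a +ᵥ cell L := by
  obtain ⟨l, hl, h⟩ := exists_sub_mem_cell L (z - a)
  exact ⟨l, hl, z - a - l, h, by simp only [vadd_eq_add]; ring⟩

open scoped Pointwise in
/-- Some fundamental parallelogram is a neighbourhood of a given point. -/
lemma exists_vadd_cell_mem_nhds (L : PeriodPair) (p : ℂ) : ∃ a : ℂ, a +ᵥ cell L ∈ 𝓝 p := by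
  set q : ℂ := (1 / 2 : ℝ) • L.ω₁ + (1 / 2 : ℝ) • L.ω₂ with hq
  have hc : cell L ∈ 𝓝 q := by
    have : cell L = ⋂ i, {z | L.basis.repr z i ∈ Set.Ico (0 : ℝ) 1} := by
      ext z; simp [ZSpan.mem_fundamentalDomain]
    rw [this, iInter_mem]
    intro i
    have hcont : Continuous fun z => L.basis.repr z i := by
      have := (L.basis.coord i).continuous_of_finiteDimensional
      exact this
    refine hcont.continuousAt.preimage_mem_nhds ?_
    have hv : L.basis.repr q i = 1 / 2 := by
      rw [hq, ← L.basis_zero, ← L.basis_one, map_add, map_smul, map_smul, Finsupp.add_apply,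
        Finsupp.smul_apply, Finsupp.smul_apply, L.basis.repr_self, L.basis.repr_self]
      fin_cases i <;> simp
    rw [hv]
    exact Ico_mem_nhds (by norm_num) (by norm_num)
  refine ⟨p - q, ?_⟩
  have := vadd_mem_nhds_vadd (p - q) hc
  simpa using this

lemma contDiffAt_comp_sub_const {f : ℂ → ℝ} {z c : ℂ} (h : ContDiffAt ℝ 2 f (z - c)) :
    ContDiffAt ℝ 2 (fun w => f (w - c)) z :=
  ContDiffAt.comp z (g := f) h (contDiffAt_id.sub contDiffAt_const)

lemma Periodic.laplacian {L : PeriodPair} {f : ℂ → ℝ} (hf : Periodic L f) :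
    Periodic L (Laplacian.laplacian f) := by
  intro l hl z
  rw [laplacian_eq_fderiv_fderiv, laplacian_eq_fderiv_fderiv, hf.fderiv.fderiv l hl z]

lemma laplacian_comp_sub_const (f : ℂ → ℝ) (c z : ℂ) :
    Laplacian.laplacian (fun w => f (w - c)) z = Laplacian.laplacian f (z - c) := by
  rw [laplacian_eq_fderiv_fderiv, laplacian_eq_fderiv_fderiv]
  have h1 : fderiv ℝ (fun w => f (w - c)) = fun w => fderiv ℝ f (w - c) := by
    ext1 w
    simp only [sub_eq_add_neg, fderiv_comp_add_right]
  have h2 := fderiv_comp_add_right (f := fderiv ℝ f) (x := z) (𝕜 := ℝ) (-c)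
  simp only [← sub_eq_add_neg] at h2
  rw [h1, h2]

open scoped Pointwise in
/-- A periodic function that is smooth off the translates of `p` by the lattice, equal to
`log |z - p|` near `p`, and whose Laplacian has integral `-2π`. It is the periodization of a cut-off
logarithm. -/
lemma exists_periodic_log (L : PeriodPair) (p : ℂ) : ∃ S : ℂ → ℝ, Periodic L S ∧
    (∀ z, z - p ∉ L.lattice → ContDiffAt ℝ 2 S z) ∧
    (S =ᶠ[𝓝 p] fun z => Real.log ‖z - p‖) ∧
    IntegrableOn (Laplacian.laplacian S) (cell L) ∧
    ∫ z in cell L, Laplacian.laplacian S z = -(2 * Real.pi) := by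
  obtain ⟨a, ha⟩ := exists_vadd_cell_mem_nhds L p
  obtain ⟨R, hR, hball⟩ := Metric.mem_nhds_iff.mp ha
  obtain ⟨θ, h1, h2, h3⟩ := exists_log_profile (a := R ^ 2 / 8) (by positivity)
  obtain ⟨hgi, hgI⟩ := integral_laplacian_log_profile (by positivity) h1 h2 h3
  set g : ℂ → ℝ := fun z => θ (Complex.normSq z) with hg
  have hg0 : ∀ z, R / 2 < ‖z‖ → g z = 0 := by
    intro z hz
    refine h3 _ ?_
    rw [Complex.normSq_eq_norm_sq]
    nlinarith
  have hgc : ∀ z, z ≠ 0 → ContDiffAt ℝ 2 g z := by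
    intro z hz
    exact ContDiffAt.comp z (h1 _ (Complex.normSq_pos.mpr hz)) contDiff_normSq.contDiffAt
  have hglog : ∀ᶠ z in 𝓝 (0 : ℂ), g z = Real.log ‖z‖ := by
    have : Metric.ball (0 : ℂ) (R / 4) ∈ 𝓝 (0 : ℂ) := Metric.ball_mem_nhds _ (by positivity)
    filter_upwards [this] with z hz
    rw [mem_ball_zero_iff] at hz
    have hlt : Complex.normSq z < R ^ 2 / 8 := by
      rw [Complex.normSq_eq_norm_sq]
      nlinarith [norm_nonneg z]
    simp only [hg]
    rw [h2 _ hlt, Complex.normSq_eq_norm_sq, Real.log_pow]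
    push_cast
    ring
  set S : ℂ → ℝ := fun z => ∑' l : L.lattice, g (z - p - l) with hS
  have hSp : Periodic L S := by
    intro l hl z
    simp only [hS]
    rw [← (Equiv.addRight (⟨l, hl⟩ : L.lattice)).tsum_eq (fun k : L.lattice => g (z + l - p - k))]
    refine tsum_congr fun k => ?_
    congr 1
    simp only [Equiv.coe_addRight, Submodule.coe_add]
    ring
  -- On the parallelogram around `p` only the term `l = 0` contributes.
  have hloc : ∀ z ∈ a +ᵥ cell L, S =ᶠ[𝓝 z] fun w => g (w - p) := by
    intro z hz
    filter_upwards [Metric.ball_mem_nhds z (half_pos hR)] with w hw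
    simp only [hS]
    rw [tsum_eq_single (0 : L.lattice)]
    · simp
    · intro l hl
      refine hg0 _ ?_
      by_contra! hle
      refine hl (Subtype.ext ?_)
      refine eq_zero_of_mem_vadd_cell l.2 hz (hball ?_)
      rw [Metric.mem_ball, Complex.dist_eq] at *
      calc ‖z - l - p‖ = ‖(w - p - l) - (w - z)‖ := by congr 1; ring
        _ ≤ ‖w - p - l‖ + ‖w - z‖ := norm_sub_le _ _
        _ < R := by linarith
  have hpF : p ∈ a +ᵥ cell L := mem_of_mem_nhds ha
  have hlap : ∀ z ∈ a +ᵥ cell L,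
      Laplacian.laplacian S z = Laplacian.laplacian g (z - p) := by
    intro z hz
    rw [(InnerProductSpace.laplacian_congr_nhds (hloc z hz)).eq_of_nhds,
      laplacian_comp_sub_const]
  have hmeas : MeasurableSet (a +ᵥ cell L) := (measurableSet_cell L).const_vadd a
  refine ⟨S, hSp, ?_, ?_, ?_, ?_⟩
  · intro z hz
    obtain ⟨l, hl, hzl⟩ := exists_sub_mem_vadd_cell L a z
    have : S = fun w => S (w - l) := by
      ext w
      have := hSp l hl (w - l)
      rwa [sub_add_cancel] at this
    rw [this]
    refine contDiffAt_comp_sub_const ?_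
    refine ContDiffAt.congr_of_eventuallyEq ?_ (hloc _ hzl)
    refine contDiffAt_comp_sub_const (hgc _ fun h0 => hz ?_)
    have : z - p = l := by linear_combination h0
    rwa [this]
  · refine (hloc p hpF).trans ?_
    have ht : Tendsto (fun w : ℂ => w - p) (𝓝 p) (𝓝 0) := by
      have : Tendsto (fun w : ℂ => w - p) (𝓝 p) (𝓝 (p - p)) :=
        (continuous_id.sub continuous_const).tendsto _
      rwa [sub_self] at this
    exact ht.eventually hglog
  · have h : IntegrableOn (Laplacian.laplacian S) (a +ᵥ cell L) :=
      ((hgi.comp_sub_right p).integrableOn).congr_fun (fun z hz => (hlap z hz).symm) hmeas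
    have hcount : Countable (Submodule.span ℤ (Set.range L.basis)).toAddSubgroup :=
      inferInstanceAs (Countable (Submodule.span ℤ (Set.range L.basis)))
    refine ((isAddFundamentalDomain_vadd_cell L a).integrableOn_iff
      (isAddFundamentalDomain_cell L) ?_).mp h
    intro l x
    have hl : (l : ℂ) ∈ L.lattice := by
      rw [L.lattice_eq_span_range_basis]; exact l.2
    have := hSp.laplacian l hl x
    rw [add_comm] at this
    exact this
  · rw [← setIntegral_vadd_cell hSp.laplacian a, setIntegral_congr_fun hmeas hlap, ← hgI,
      ← integral_sub_right_eq_self (Laplacian.laplacian g) p]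
    refine setIntegral_eq_integral_of_forall_compl_eq_zero fun z hz => ?_
    have hz' : R ≤ ‖z - p‖ := by
      by_contra! h
      exact hz (hball (by rwa [Metric.mem_ball, Complex.dist_eq]))
    have : g =ᶠ[𝓝 (z - p)] fun _ => 0 := by
      have : {w : ℂ | R / 2 < ‖w‖} ∈ 𝓝 (z - p) :=
        (isOpen_lt continuous_const continuous_norm).mem_nhds (by
          simp only [Set.mem_ofPred_eq]; linarith)
      filter_upwards [this] with w hw using hg0 w hw
    rw [(InnerProductSpace.laplacian_congr_nhds this).eq_of_nhds]
    simp

lemma eventually_nhdsNE_sub_notMem (L : PeriodPair) (p z : ℂ) :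
    ∀ᶠ w in 𝓝[≠] z, w - p ∉ L.lattice := by
  have := L.compl_lattice_sdiff_singleton_mem_nhds (z - p)
  have hc : ContinuousAt (fun w : ℂ => w - p) z :=
    (continuous_id.sub continuous_const).continuousAt
  filter_upwards [nhdsWithin_le_nhds (hc.preimage_mem_nhds this), self_mem_nhdsWithin]
    with w hw hne hmem
  refine hw ⟨hmem, fun e => hne ?_⟩
  rw [Set.mem_singleton_iff] at *
  linear_combination e

/-- Integral of the Laplacian of a function on the torus with one logarithmic singularity: as a
distribution, the Laplacian has total integral zero and a mass `2π n` at the singularity. -/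
theorem integral_laplacian_of_log_singularity {L : PeriodPair} {p : ℂ} {U : ℂ → ℝ} {n : ℝ}
    (hU : Periodic L U)
    (hreg : ∀ z, z - p ∉ L.lattice → ∃ s : ℂ → ℝ, ContDiffAt ℝ 2 s z ∧ U =ᶠ[𝓝[≠] z] s)
    (hsing : ∃ s : ℂ → ℝ, ContDiffAt ℝ 2 s p ∧
      U =ᶠ[𝓝[≠] p] fun z => n * Real.log ‖z - p‖ + s z) :
    ∫ z in cell L, Laplacian.laplacian U z = -(2 * Real.pi * n) := by
  obtain ⟨S, hSp, hSc, hSlog, hSi, hSI⟩ := exists_periodic_log L p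
  have hV : Periodic L (fun z => U z - n * S z) := fun l hl z => by
    simp only [hU l hl z, hSp l hl z]
  have hVs : ∀ z, ∃ s : ℂ → ℝ, ContDiffAt ℝ 2 s z ∧ (fun z => U z - n * S z) =ᶠ[𝓝[≠] z] s := by
    intro z
    by_cases hz : z - p ∈ L.lattice
    · -- Near `z`, the difference is the translate of the smooth part of `U` at `p`.
      obtain ⟨s, hs, hUs⟩ := hsing
      have hp : (fun z => U z - n * S z) =ᶠ[𝓝[≠] p] s := by
        filter_upwards [hUs, hSlog.filter_mono nhdsWithin_le_nhds] with w h1 h2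
        rw [h1, h2]
        ring
      refine ⟨fun w => s (w - (z - p)), contDiffAt_comp_sub_const (by rwa [sub_sub_cancel]), ?_⟩
      have hm := tendsto_nhdsNE_of_injective (continuous_sub_right (z - p))
        sub_left_injective z
      rw [sub_sub_cancel] at hm
      filter_upwards [hm.eventually hp] with w hw
      rw [← hw]
      have := hV _ hz (w - (z - p))
      rw [sub_add_cancel] at this
      exact this
    · obtain ⟨s, hs, hUs⟩ := hreg z hz
      refine ⟨fun w => s w - n * S w, hs.sub (contDiffAt_const.mul (hSc z hz)), ?_⟩
      filter_upwards [hUs] with w hw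
      rw [hw]
  obtain ⟨hVi, hVI⟩ := integral_laplacian_of_removable hV hVs
  have hae : Laplacian.laplacian U =ᵐ[volume] fun z =>
      Laplacian.laplacian (fun z => U z - n * S z) z + n * Laplacian.laplacian S z := by
    refine ae_of_eventually_nhdsNE fun z => ?_
    obtain ⟨s, hs, hVs⟩ := hVs z
    have h1 := eventually_nhdsNE_eventually_nhds hVs
    have h2 : ∀ᶠ w in 𝓝[≠] z, ContDiffAt ℝ 2 s w :=
      (hs.eventually (by simp)).filter_mono nhdsWithin_le_nhds
    have h3 := eventually_nhdsNE_sub_notMem L p z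
    filter_upwards [h1, h2, h3] with w hw1 hw2 hw3
    have hVw : ContDiffAt ℝ 2 (fun z => U z - n * S z) w := hw2.congr_of_eventuallyEq hw1
    have hnS : ContDiffAt ℝ 2 (fun z => n * S z) w := contDiffAt_const.mul (hSc w hw3)
    have e : U = (fun z => U z - n * S z) + fun z => n * S z := by
      ext z; simp
    conv_lhs => rw [e]
    rw [ContDiffAt.laplacian_add hVw hnS]
    congr 1
    have := InnerProductSpace.laplacian_smul n (hSc w hw3)
    simpa [Pi.smul_def] using this
  rw [integral_congr_ae (ae_restrict_of_ae hae), integral_add (hVi _ (isBounded_cell L))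
    (hSi.const_mul n), hVI, integral_const_mul, hSI]
  ring

/-! ### Elliptic functions with a pole of small order -/

lemma eventually_codiscrete_iff {P : ℂ → Prop} :
    (∀ᶠ z in codiscrete ℂ, P z) ↔ ∀ z, ∀ᶠ w in 𝓝[≠] z, P w := by
  refine ⟨fun h z => ?_, fun h => mem_codiscrete_of_eventually h⟩
  have := mem_codiscrete.mp h z
  rwa [disjoint_principal_right, compl_compl] at this

lemma tendsto_codiscrete_of_injective {g : ℂ → ℂ} (hg : Continuous g)
    (hi : Function.Injective g) : Tendsto g (codiscrete ℂ) (codiscrete ℂ) := by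
  intro s hs
  exact mem_codiscrete_of_eventually fun z =>
    (tendsto_nhdsNE_of_injective hg hi z).eventually (eventually_codiscrete_iff.mp hs (g z))

/-- Functions in normal form are determined by their values off a discrete set. -/
lemma eq_of_meromorphicNF {f g : ℂ → ℂ} (hf : ∀ z, MeromorphicNFAt f z)
    (hg : ∀ z, MeromorphicNFAt g z) (h : f =ᶠ[codiscrete ℂ] g) : f = g := by
  ext z
  exact (((hf z).eventuallyEq_nhdsNE_iff_eventuallyEq_nhds (hg z)).mp
    (eventually_codiscrete_iff.mp h z)).eq_of_nhds

/-- The normal form of a meromorphic function on `ℂ`. -/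
noncomputable abbrev normalForm (f : ℂ → ℂ) : ℂ → ℂ := toMeromorphicNFOn f Set.univ

lemma meromorphicNFAt_normalForm (f : ℂ → ℂ) (z : ℂ) : MeromorphicNFAt (normalForm f) z :=
  meromorphicNFOn_toMeromorphicNFOn f Set.univ (Set.mem_univ z)

lemma normalForm_eventuallyEq {f : ℂ → ℂ} (hf : Meromorphic f) :
    normalForm f =ᶠ[codiscrete ℂ] f :=
  eventually_codiscrete_iff.mpr fun z =>
    MeromorphicOn.toMeromorphicNFOn_eq_self_on_nhdsNE (fun z _ => hf z) (Set.mem_univ z)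

lemma meromorphicOrderAt_normalForm {f : ℂ → ℂ} (hf : Meromorphic f) (z : ℂ) :
    meromorphicOrderAt (normalForm f) z = meromorphicOrderAt f z :=
  meromorphicOrderAt_toMeromorphicNFOn (fun z _ => hf z) (Set.mem_univ z)

lemma analyticAt_normalForm {f : ℂ → ℂ} (hf : Meromorphic f) {z : ℂ}
    (h : 0 ≤ meromorphicOrderAt f z) : AnalyticAt ℂ (normalForm f) z := by
  rw [← meromorphicOrderAt_normalForm hf] at h
  exact (meromorphicNFAt_normalForm f z).meromorphicOrderAt_nonneg_iff_analyticAt.mp h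

lemma Periodic.normalForm {L : PeriodPair} {f : ℂ → ℂ} (hf : Meromorphic f) (hp : Periodic L f) :
    Periodic L (normalForm f) := by
  intro l hl
  refine congrFun (eq_of_meromorphicNF (f := fun z => StationaryTorus.normalForm f (z + l))
    (fun z => (meromorphicNFAt_normalForm f (z + l)).comp_analyticAt (g := fun z => z + l)
      (by fun_prop)) (meromorphicNFAt_normalForm f) ?_)
  have h := (normalForm_eventuallyEq hf).comp_tendsto
    (tendsto_codiscrete_of_injective (continuous_add_const l) (add_left_injective l))
  filter_upwards [h, normalForm_eventuallyEq hf] with z h1 h2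
  rw [h2, ← hp l hl z]
  exact h1

lemma Periodic.meromorphicOrderAt {L : PeriodPair} {f : ℂ → ℂ} (hp : Periodic L f) :
    Periodic L (meromorphicOrderAt f) := by
  intro l hl z
  rw [← meromorphicOrderAt_comp_add_const_eq_meromorphicOrderAt]
  congr 1
  ext w
  exact hp l hl w

lemma meromorphicOrderAt_reflect (f : ℂ → ℂ) (c z : ℂ) :
    meromorphicOrderAt (fun w => f (c - w)) z = meromorphicOrderAt f (c - z) := by
  have hd : deriv (fun w : ℂ => c - w) z = -1 := by simp
  exact meromorphicOrderAt_comp_of_deriv_ne_zero (f := f) (g := fun w => c - w) (x := z)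
    (by fun_prop) (by rw [hd]; norm_num)

lemma meromorphic_reflect {f : ℂ → ℂ} (hf : Meromorphic f) (c : ℂ) :
    Meromorphic fun w => f (c - w) := fun z =>
  (hf (c - z)).comp_analyticAt (g := fun w => c - w) (by fun_prop)

lemma tendsto_codiscrete_reflect (c : ℂ) :
    Tendsto (fun w : ℂ => c - w) (codiscrete ℂ) (codiscrete ℂ) :=
  tendsto_codiscrete_of_injective (by fun_prop) sub_right_injective

/-- Liouville's theorem for elliptic functions: without poles they are constant. -/
theorem eventuallyEq_const_of_order_nonneg {L : PeriodPair} {f : ℂ → ℂ} (hf : Meromorphic f)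
    (hp : Periodic L f) (h0 : ∀ z, 0 ≤ meromorphicOrderAt f z) :
    ∃ c, f =ᶠ[codiscrete ℂ] fun _ => c := by
  have hd : Differentiable ℂ (normalForm f) := fun z =>
    (analyticAt_normalForm hf (h0 z)).differentiableAt
  obtain ⟨C, hC⟩ := (Periodic.normalForm hf hp).exists_bound hd.continuous
  refine ⟨normalForm f 0, ?_⟩
  filter_upwards [normalForm_eventuallyEq hf] with z hz
  rw [← hz]
  refine hd.apply_eq_apply_of_bounded ?_ z 0
  refine isBounded_iff_forall_norm_le.mpr ⟨C, ?_⟩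
  rintro _ ⟨w, rfl⟩
  exact hC w

lemma order_pos_of_apply_eq_zero {f : ℂ → ℂ} {z : ℂ} (hf : AnalyticAt ℂ f z) (h : f z = 0) :
    1 ≤ meromorphicOrderAt f z := by
  rw [hf.meromorphicOrderAt_eq]
  have : analyticOrderAt f z ≠ 0 := hf.analyticOrderAt_ne_zero.mpr h
  cases hn : analyticOrderAt f z with
  | top => simp
  | coe n =>
    rw [hn] at this
    have h1 : 1 ≤ n := Nat.one_le_iff_ne_zero.mpr (by exact_mod_cast this)
    simp only [ENat.map_natCast]
    exact_mod_cast h1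

/-- The antisymmetric part about `p` of a function with a pole of order at most `2` at `p` has a
pole of order at most `1` there. -/
lemma order_sub_reflect {f : ℂ → ℂ} (hf : Meromorphic f) {p : ℂ}
    (h : ((-2 : ℤ) : WithTop ℤ) ≤ meromorphicOrderAt f p) :
    ((-1 : ℤ) : WithTop ℤ) ≤ meromorphicOrderAt (fun z => f z - f (2 * p - z)) p := by
  have hsq : Meromorphic fun z : ℂ => (z - p) ^ 2 := fun z => by fun_prop
  have hsqo : meromorphicOrderAt (fun z : ℂ => (z - p) ^ 2) p = ((2 : ℤ) : WithTop ℤ) := by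
    have := fun_meromorphicOrderAt_pow_id_sub_const (𝕜 := ℂ) (x := p) (n := 2)
    simpa using this
  set k : ℂ → ℂ := fun z => (z - p) ^ 2 * f z with hk
  have hkm : Meromorphic k := fun z => (hsq z).mul (hf z)
  have hko : 0 ≤ meromorphicOrderAt k p := by
    have : meromorphicOrderAt k p = ((2 : ℤ) : WithTop ℤ) + meromorphicOrderAt f p := by
      rw [← hsqo]; exact meromorphicOrderAt_mul (hsq p) (hf p)
    rw [this]
    cases hn : meromorphicOrderAt f p with
    | top => simp
    | coe n =>
      rw [hn] at h
      rw [WithTop.coe_le_coe] at h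
      rw [← WithTop.coe_add, ← WithTop.coe_zero, WithTop.coe_le_coe]
      omega
  have hka := analyticAt_normalForm hkm hko
  set m : ℂ → ℂ := fun z => normalForm k z - normalForm k (2 * p - z) with hm
  have hma : AnalyticAt ℂ m p := by
    refine hka.sub ?_
    have : AnalyticAt ℂ (normalForm k) ((fun z => 2 * p - z) p) := by
      have e : 2 * p - p = p := by ring
      simp only [e]
      exact hka
    exact this.comp (g := normalForm k) (f := fun z => 2 * p - z) (by fun_prop)
  have hm0 : m p = 0 := by
    simp only [hm]
    rw [show 2 * p - p = p by ring, sub_self]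
  have hmo := order_pos_of_apply_eq_zero hma hm0
  set g : ℂ → ℂ := fun z => f z - f (2 * p - z) with hg
  have hgm : Meromorphic g := fun z => (hf z).sub (meromorphic_reflect hf _ z)
  have heq : (fun z => (z - p) ^ 2 * g z) =ᶠ[𝓝[≠] p] m := by
    have e1 := normalForm_eventuallyEq hkm
    have e2 := e1.comp_tendsto (tendsto_codiscrete_reflect (2 * p))
    refine eventually_codiscrete_iff.mp ?_ p
    filter_upwards [e1, e2] with z h1 h2
    simp only [Function.comp_apply] at h2
    simp only [hm, hg]
    rw [h1, h2]
    simp only [hk]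
    ring
  have hsum : ((2 : ℤ) : WithTop ℤ) + meromorphicOrderAt g p = meromorphicOrderAt m p := by
    rw [← meromorphicOrderAt_congr heq, ← hsqo]
    exact (meromorphicOrderAt_mul (hsq p) (hgm p)).symm
  rw [← hsum] at hmo
  cases hn : meromorphicOrderAt g p with
  | top => simp
  | coe n =>
    rw [hn] at hmo
    rw [← WithTop.coe_add, ← WithTop.coe_one, WithTop.coe_le_coe] at hmo
    rw [WithTop.coe_le_coe]
    omega

lemma add_half_notMem_lattice (L : PeriodPair) : (L.ω₁ + L.ω₂) / 2 ∉ L.lattice := by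
  have := (L.mul_ω₁_add_mul_ω₂_mem_lattice (α := 1 / 2) (β := 1 / 2)).not.mpr (by norm_num)
  intro h
  apply this
  convert h using 1
  push_cast
  ring

lemma order_add_nonneg {a b : WithTop ℤ} (ha : ((-1 : ℤ) : WithTop ℤ) ≤ a) (hb : 1 ≤ b) : 0 ≤ a + b := by
  have := add_le_add ha hb
  exact this

/-- An elliptic function that is odd about `p` and has at most a simple pole at `p`, and no other
poles modulo the lattice, vanishes. It vanishes at the points `p + w` with `w` a nonzero half
period; hence `g z * g (z + ω₁ / 2)` has no poles and has a zero, so it is identically zero. -/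
lemma eventuallyEq_zero_of_odd {L : PeriodPair} {p : ℂ} {g : ℂ → ℂ} (hg : Meromorphic g)
    (hp : Periodic L g) (hodd : ∀ z, g (2 * p - z) = -g z)
    (h0 : ∀ z, z - p ∉ L.lattice → 0 ≤ meromorphicOrderAt g z)
    (h1 : ((-1 : ℤ) : WithTop ℤ) ≤ meromorphicOrderAt g p) : g =ᶠ[codiscrete ℂ] fun _ => 0 := by
  set G := normalForm g with hG
  have hGNF : ∀ z, MeromorphicNFAt G z := meromorphicNFAt_normalForm g
  have hGm : Meromorphic G := fun z => (hGNF z).meromorphicAt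
  have hGp : Periodic L G := Periodic.normalForm hg hp
  have hGo : ∀ z, meromorphicOrderAt G z = meromorphicOrderAt g z :=
    meromorphicOrderAt_normalForm hg
  have hGa : ∀ z, z - p ∉ L.lattice → AnalyticAt ℂ G z := fun z hz =>
    analyticAt_normalForm hg (h0 z hz)
  have hGodd : ∀ z, G (2 * p - z) = -G z := by
    have hcomp : ∀ z, MeromorphicNFAt (fun w => G (2 * p - w)) z := fun z =>
      (hGNF (2 * p - z)).comp_analyticAt (g := fun w => 2 * p - w) (by fun_prop)
    have hneg : ∀ z, MeromorphicNFAt (fun w => -G w) z := by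
      intro z
      have := (meromorphicNFAt_mul_iff_right (f := G) (g := fun _ : ℂ => (-1 : ℂ)) (x := z)
        analyticAt_const (by norm_num)).mpr (hGNF z)
      refine (meromorphicNFAt_congr (Eventually.of_forall fun w => ?_)).mp this
      simp
    refine congrFun (eq_of_meromorphicNF hcomp hneg ?_)
    have e1 := normalForm_eventuallyEq hg
    have e2 := e1.comp_tendsto (tendsto_codiscrete_reflect (2 * p))
    filter_upwards [e1, e2] with z h1 h2
    simp only [Function.comp_apply] at h2
    rw [hG, h2, h1, hodd]
  -- Oddness and periodicity give `G (p + w) = -G (p + w)` at half periods `w`.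
  have hhalf : ∀ w, w + w ∈ L.lattice → G (p + w) = 0 := by
    intro w hw
    have e1 := hGodd (p + w)
    have e2 := hGp _ hw (2 * p - (p + w))
    rw [show 2 * p - (p + w) + (w + w) = p + w by ring] at e2
    rw [← e2] at e1
    exact self_eq_neg.mp e1
  have hzero : ∀ z, z - p ∉ L.lattice → (z - p) + (z - p) ∈ L.lattice →
      1 ≤ meromorphicOrderAt G z := by
    intro z hz hzz
    refine order_pos_of_apply_eq_zero (hGa z hz) ?_
    have := hhalf (z - p) hzz
    rwa [add_sub_cancel] at this
  have hpole : ∀ z, z - p ∈ L.lattice → ((-1 : ℤ) : WithTop ℤ) ≤ meromorphicOrderAt G z := by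
    intro z hz
    have := hGp.meromorphicOrderAt _ hz p
    rw [add_sub_cancel] at this
    rw [this, hGo]
    exact h1
  have hw1 := L.ω₁_div_two_notMem_lattice
  have hω : L.ω₁ / 2 + L.ω₁ / 2 ∈ L.lattice := by
    rw [add_halves]; exact L.ω₁_mem_lattice
  -- The simple pole of each factor meets a zero of the other.
  set H : ℂ → ℂ := fun z => G z * G (z + L.ω₁ / 2) with hH
  have hG2 : Meromorphic fun z => G (z + L.ω₁ / 2) := fun z =>
    (hGm (z + L.ω₁ / 2)).comp_analyticAt (g := fun w => w + L.ω₁ / 2) (by fun_prop)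
  have hHm : Meromorphic H := fun z => (hGm z).mul (hG2 z)
  have hHp : Periodic L H := by
    intro l hl z
    simp only [hH]
    rw [hGp l hl z, show z + l + L.ω₁ / 2 = z + L.ω₁ / 2 + l by ring, hGp l hl]
  have hHo : ∀ z, meromorphicOrderAt H z =
      meromorphicOrderAt G z + meromorphicOrderAt G (z + L.ω₁ / 2) := by
    intro z
    rw [← meromorphicOrderAt_comp_add_const_eq_meromorphicOrderAt]
    exact meromorphicOrderAt_mul (hGm z) (hG2 z)
  have hHnn : ∀ z, 0 ≤ meromorphicOrderAt H z := by
    intro z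
    rw [hHo]
    by_cases c1 : z - p ∈ L.lattice
    · refine order_add_nonneg (hpole z c1) (hzero _ ?_ ?_)
      · intro h
        have := sub_mem h c1
        exact hw1 (by convert this using 1; ring)
      · have := add_mem (add_mem c1 c1) hω
        convert this using 1; ring
    · by_cases c2 : z + L.ω₁ / 2 - p ∈ L.lattice
      · rw [add_comm]
        refine order_add_nonneg (hpole _ c2) (hzero _ c1 ?_)
        have := sub_mem (add_mem c2 c2) hω
        convert this using 1; ring
      · rw [hGo, hGo]
        exact add_nonneg (h0 z c1) (h0 _ c2)
  obtain ⟨c, hc⟩ := eventuallyEq_const_of_order_nonneg hHm hHp hHnn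
  set q := p + L.ω₂ / 2 with hq
  have hq1 : q - p ∉ L.lattice := by
    rw [hq, add_sub_cancel_left]; exact L.ω₂_div_two_notMem_lattice
  have hq2 : q + L.ω₁ / 2 - p ∉ L.lattice := by
    have := add_half_notMem_lattice L
    rwa [show q + L.ω₁ / 2 - p = (L.ω₁ + L.ω₂) / 2 by rw [hq]; ring]
  have hGq : G q = 0 := hhalf _ (by rw [add_halves]; exact L.ω₂_mem_lattice)
  have hc0 : c = 0 := by
    have ha : ContinuousAt H q := by
      have a2 : ContinuousAt (fun z => G (z + L.ω₁ / 2)) q :=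
        ContinuousAt.comp (f := fun z => z + L.ω₁ / 2) (g := G)
          (hGa _ hq2).continuousAt (by fun_prop)
      exact (hGa q hq1).continuousAt.mul a2
    have t1 : Tendsto H (𝓝[≠] q) (𝓝 (H q)) := ha.tendsto.mono_left nhdsWithin_le_nhds
    have t2 : Tendsto H (𝓝[≠] q) (𝓝 c) :=
      tendsto_const_nhds.congr' ((eventually_codiscrete_iff.mp hc q).mono fun _ h => h.symm)
    have := tendsto_nhds_unique t1 t2
    rw [← this]
    simp only [hH]
    rw [hGq, zero_mul]
  have htop : meromorphicOrderAt H q = ⊤ := by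
    rw [meromorphicOrderAt_eq_top_iff]
    have := eventually_codiscrete_iff.mp hc q
    rwa [hc0] at this
  rw [hHo, WithTop.add_eq_top] at htop
  have hex : ∃ z, meromorphicOrderAt G z = ⊤ := by
    rcases htop with h | h
    · exact ⟨_, h⟩
    · exact ⟨_, h⟩
  obtain ⟨z0, hz0⟩ := hex
  refine eventually_codiscrete_iff.mpr fun z => ?_
  rw [← meromorphicOrderAt_eq_top_iff, ← hGo]
  by_contra hne
  exact MeromorphicOn.meromorphicOrderAt_ne_top_of_isPreconnected (fun z _ => hGm z)
    isPreconnected_univ (Set.mem_univ z) (Set.mem_univ z0) hne hz0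

/-- An elliptic function whose only pole, modulo the lattice, is at `p` and has order at most `2`
is even about `p`. -/
theorem even_of_order_ge_neg_two {L : PeriodPair} {p : ℂ} {f : ℂ → ℂ} (hf : Meromorphic f)
    (hp : Periodic L f) (h0 : ∀ z, z - p ∉ L.lattice → 0 ≤ meromorphicOrderAt f z)
    (h2 : ((-2 : ℤ) : WithTop ℤ) ≤ meromorphicOrderAt f p) :
    (fun z => f (2 * p - z)) =ᶠ[codiscrete ℂ] f := by
  have hrefl : ∀ z, z - p ∉ L.lattice → 2 * p - z - p ∉ L.lattice := by
    intro z hz h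
    have := neg_mem h
    exact hz (by convert this using 1; ring)
  have hm : Meromorphic fun z => f z - f (2 * p - z) := fun z =>
    (hf z).sub (meromorphic_reflect hf _ z)
  have key := eventuallyEq_zero_of_odd (L := L) (p := p) (g := fun z => f z - f (2 * p - z)) hm
    ?_ ?_ ?_ (order_sub_reflect hf h2)
  · filter_upwards [key] with z hz
    exact (sub_eq_zero.mp hz).symm
  · intro l hl z
    have := hp (-l) (neg_mem hl) (2 * p - z)
    beta_reduce
    rw [hp l hl z, ← this]
    ring_nf
  · intro z
    rw [show 2 * p - (2 * p - z) = z by ring]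
    ring
  · intro z hz
    have e : (fun z => f z - f (2 * p - z)) = f + -(fun z => f (2 * p - z)) := by
      ext w; simp [sub_eq_add_neg]
    rw [e]
    refine le_trans ?_ (meromorphicOrderAt_add (hf z) (meromorphic_reflect hf _ z).neg)
    rw [← meromorphicOrderAt_neg (f := fun z => f (2 * p - z)), meromorphicOrderAt_reflect]
    exact le_min (h0 z hz) (h0 _ (hrefl z hz))

/-! ### The conformal factor and the total curvature -/

lemma proj_eq_proj_iff {L : PeriodPair} {z w : ℂ} : proj L z = proj L w ↔ z - w ∈ L.lattice :=
  Submodule.Quotient.eq L.lattice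

lemma proj_mem_punctured_iff {L : PeriodPair} {z p : ℂ} :
    proj L z ∈ punctured L p ↔ z - p ∉ L.lattice :=
  proj_eq_proj_iff.not

lemma periodic_lift {L : PeriodPair} (X : Torus L → Fin 4 → ℝ) : Periodic L (lift X) := by
  intro l hl z
  simp only [lift]
  rw [proj_eq_proj_iff.mpr]
  rwa [add_sub_cancel_left]

lemma periodic_confFactor {L : PeriodPair} (X : Torus L → Fin 4 → ℝ) :
    Periodic L (confFactor X) := by
  intro l hl z
  simp only [confFactor]
  rw [(periodic_lift X).fderiv l hl z]

lemma poleOrder_of_nonneg {f : ℂ → ℂ} {z : ℂ} (h : 0 ≤ meromorphicOrderAt f z) :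
    poleOrder f z = 0 := by
  simp only [poleOrder]
  cases hn : meromorphicOrderAt f z with
  | top => simp
  | coe n =>
    rw [hn, ← WithTop.coe_zero, WithTop.coe_le_coe] at h
    simpa using h

lemma order_eq_neg_poleOrder {f : ℂ → ℂ} {z : ℂ} (h : meromorphicOrderAt f z < 0) :
    0 < poleOrder f z ∧ meromorphicOrderAt f z = ((-(poleOrder f z : ℤ) : ℤ) : WithTop ℤ) := by
  simp only [poleOrder]
  cases hn : meromorphicOrderAt f z with
  | top => simp [hn] at h
  | coe n =>
    rw [hn, ← WithTop.coe_zero, WithTop.coe_lt_coe] at h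
    simp only [WithTop.untop₀_coe]
    refine ⟨by omega, ?_⟩
    rw [WithTop.coe_inj]
    omega

lemma contDiffAt_real_of_analyticAt {f : ℂ → ℂ} {z : ℂ} (hf : AnalyticAt ℂ f z) :
    ContDiffAt ℝ 2 f z :=
  (hf.contDiffAt (n := 2)).restrict_scalars ℝ

lemma contDiffAt_conj {f : ℂ → ℂ} {z : ℂ} (hf : ContDiffAt ℝ 2 f z) :
    ContDiffAt ℝ 2 (fun w => starRingEnd ℂ (f w)) z :=
  (Complex.conjCLE.contDiff (n := 2)).contDiffAt.comp z hf

/-- If `f` is `(z - z₀) ^ e` times a nonvanishing `C²` function, then `log (4 |f|²)` is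
`2 e log |z - z₀|` plus a `C²` function. -/
lemma exists_log_normSq_expansion {f a : ℂ → ℂ} {z₀ : ℂ} {e : ℤ} (ha : ContDiffAt ℝ 2 a z₀)
    (h0 : a z₀ ≠ 0) (hf : f =ᶠ[𝓝[≠] z₀] fun z => (z - z₀) ^ e * a z) :
    (∀ᶠ z in 𝓝[≠] z₀, f z ≠ 0) ∧ ∃ s : ℂ → ℝ, ContDiffAt ℝ 2 s z₀ ∧
      (fun z => Real.log (4 * Complex.normSq (f z))) =ᶠ[𝓝[≠] z₀]
        fun z => (2 * e : ℝ) * Real.log ‖z - z₀‖ + s z := by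
  have hne : ∀ᶠ z in 𝓝[≠] z₀, a z ≠ 0 :=
    nhdsWithin_le_nhds (ha.continuousAt.eventually_ne h0)
  refine ⟨?_, fun z => Real.log (4 * Complex.normSq (a z)), ?_, ?_⟩
  · filter_upwards [hf, hne, self_mem_nhdsWithin] with z h1 h2 h3
    rw [h1]
    exact mul_ne_zero (zpow_ne_zero _ (sub_ne_zero.mpr h3)) h2
  · refine (contDiffAt_const.mul (contDiff_normSq.contDiffAt.comp z₀ ha)).log ?_
    exact mul_ne_zero four_ne_zero (Complex.normSq_pos.mpr h0).ne'
  · filter_upwards [hf, hne, self_mem_nhdsWithin] with z h1 h2 h3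
    have hz : (0 : ℝ) < ‖z - z₀‖ := norm_pos_iff.mpr (sub_ne_zero.mpr h3)
    have hz2 : (0 : ℝ) < Complex.normSq (a z) := Complex.normSq_pos.mpr h2
    rw [h1, map_mul, map_zpow₀, Complex.normSq_eq_norm_sq (z - z₀),
      mul_left_comm, Real.log_mul (by positivity) (by positivity), Real.log_zpow, Real.log_pow]
    push_cast
    ring

/-- Near any point, `(φ - conj ψ) h` is a power of `z - z₀` times a nonvanishing smooth function if
`φ ≠ conj ψ` there in the sphere and `ψ` has no pole. -/
lemma exists_factorization {φ ψ h : ℂ → ℂ} {z₀ : ℂ} {m : ℤ} (hφ : MeromorphicNFAt φ z₀)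
    (hψ : MeromorphicNFAt ψ z₀) (hh : MeromorphicAt h z₀) (hm : meromorphicOrderAt h z₀ = m)
    (hne : sphereValue φ z₀ ≠ sphereConj (sphereValue ψ z₀))
    (hψ0 : 0 ≤ meromorphicOrderAt ψ z₀) :
    ∃ a : ℂ → ℂ, ContDiffAt ℝ 2 a z₀ ∧ a z₀ ≠ 0 ∧
      (fun z => (φ z - starRingEnd ℂ (ψ z)) * h z) =ᶠ[𝓝[≠] z₀]
        fun z => (z - z₀) ^ (m - poleOrder φ z₀ - poleOrder ψ z₀) * a z := by
  obtain ⟨h₁, h1a, h1n, h1e⟩ := (meromorphicOrderAt_eq_int_iff hh).mp hm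
  have hψa := hψ.meromorphicOrderAt_nonneg_iff_analyticAt.mp hψ0
  have hψc := contDiffAt_conj (contDiffAt_real_of_analyticAt hψa)
  by_cases hφ0 : meromorphicOrderAt φ z₀ < 0
  · obtain ⟨hk, hko⟩ := order_eq_neg_poleOrder hφ0
    obtain ⟨φ₁, f1a, f1n, f1e⟩ := (meromorphicOrderAt_eq_int_iff hφ.meromorphicAt).mp hko
    rw [poleOrder_of_nonneg hψ0]
    set k := poleOrder φ z₀
    refine ⟨fun z => (φ₁ z - starRingEnd ℂ (ψ z) * (z - z₀) ^ k) * h₁ z, ?_, ?_, ?_⟩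
    · exact ((contDiffAt_real_of_analyticAt f1a).sub
        (hψc.mul ((contDiffAt_id.sub contDiffAt_const).pow k))).mul
        (contDiffAt_real_of_analyticAt h1a)
    · simp [hk.ne', f1n, h1n]
    · filter_upwards [f1e, h1e, self_mem_nhdsWithin] with z e1 e2 hz
      have hz0 : z - z₀ ≠ 0 := sub_ne_zero.mpr hz
      have e3 : (z - z₀) ^ (m - (k : ℤ) - ((0 : ℕ) : ℤ)) =
          (z - z₀) ^ m * ((z - z₀) ^ k)⁻¹ := by
        rw [Nat.cast_zero, sub_zero, zpow_sub₀ hz0, zpow_natCast, div_eq_mul_inv]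
      rw [e1, e2, e3, smul_eq_mul, smul_eq_mul, zpow_neg, zpow_natCast]
      field_simp
  · have hφ0' := not_lt.mp hφ0
    have hφa := hφ.meromorphicOrderAt_nonneg_iff_analyticAt.mp hφ0'
    rw [poleOrder_of_nonneg hψ0, poleOrder_of_nonneg hφ0']
    refine ⟨fun z => (φ z - starRingEnd ℂ (ψ z)) * h₁ z, ?_, ?_, ?_⟩
    · exact ((contDiffAt_real_of_analyticAt hφa).sub hψc).mul (contDiffAt_real_of_analyticAt h1a)
    · refine mul_ne_zero (fun h0 => hne ?_) h1n
      simp only [sphereValue, if_neg hφ0, if_neg (not_lt.mpr hψ0), sphereConj, OnePoint.map_some]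
      rw [sub_eq_zero.mp h0]
    · filter_upwards [h1e] with z e2
      rw [e2, smul_eq_mul]
      simp only [Nat.cast_zero, sub_zero]
      ring

lemma sphereConj_sphereConj (w : OnePoint ℂ) : sphereConj (sphereConj w) = w := by
  induction w using OnePoint.rec with
  | infty => rfl
  | coe z => simp [sphereConj]

lemma sphereValue_eq_infty {f : ℂ → ℂ} {z : ℂ} (h : meromorphicOrderAt f z < 0) :
    sphereValue f z = OnePoint.infty := by
  simp [sphereValue, h]

lemma not_both_poles {φ ψ : ℂ → ℂ} {z : ℂ}
    (hne : sphereValue φ z ≠ sphereConj (sphereValue ψ z)) (hφ : meromorphicOrderAt φ z < 0) :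
    0 ≤ meromorphicOrderAt ψ z := by
  by_contra! h
  apply hne
  rw [sphereValue_eq_infty hφ, sphereValue_eq_infty h]
  rfl

/-- The local expansion of the logarithm of the conformal factor `4 |φ - conj ψ|² |h|²`. Since
`|φ - conj ψ|` is symmetric in `φ` and `ψ`, one may suppose that `ψ` has no pole. -/
lemma exists_log_confFactor_expansion {φ ψ h : ℂ → ℂ} {z₀ : ℂ} {m : ℤ}
    (hφ : MeromorphicNFAt φ z₀) (hψ : MeromorphicNFAt ψ z₀) (hh : MeromorphicAt h z₀)
    (hm : meromorphicOrderAt h z₀ = m)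
    (hne : sphereValue φ z₀ ≠ sphereConj (sphereValue ψ z₀)) :
    (∀ᶠ z in 𝓝[≠] z₀,
      4 * Complex.normSq (φ z - starRingEnd ℂ (ψ z)) * Complex.normSq (h z) ≠ 0) ∧
    ∃ s : ℂ → ℝ, ContDiffAt ℝ 2 s z₀ ∧
      (fun z => Real.log (4 * Complex.normSq (φ z - starRingEnd ℂ (ψ z)) *
        Complex.normSq (h z))) =ᶠ[𝓝[≠] z₀] fun z =>
        (2 * (m - poleOrder φ z₀ - poleOrder ψ z₀ : ℤ) : ℝ) * Real.log ‖z - z₀‖ + s z := by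
  by_cases hψ0 : 0 ≤ meromorphicOrderAt ψ z₀
  · obtain ⟨a, ha, ha0, hae⟩ := exists_factorization hφ hψ hh hm hne hψ0
    obtain ⟨h1, h2⟩ := exists_log_normSq_expansion ha ha0 hae
    simp only [map_mul, ← mul_assoc] at h2
    refine ⟨?_, h2⟩
    filter_upwards [h1] with z hz
    rw [mul_assoc, ← map_mul]
    exact mul_ne_zero four_ne_zero (Complex.normSq_pos.mpr hz).ne'
  · have hne' : sphereValue ψ z₀ ≠ sphereConj (sphereValue φ z₀) := fun e => hne (by
      rw [e, sphereConj_sphereConj])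
    have hφ0 := not_both_poles hne' (not_le.mp hψ0)
    obtain ⟨a, ha, ha0, hae⟩ := exists_factorization hψ hφ hh hm hne' hφ0
    obtain ⟨h1, h2⟩ := exists_log_normSq_expansion ha ha0 hae
    have hsw : ∀ z, Complex.normSq (ψ z - starRingEnd ℂ (φ z)) =
        Complex.normSq (φ z - starRingEnd ℂ (ψ z)) := by
      intro z
      rw [← Complex.normSq_conj, map_sub, Complex.conj_conj, ← Complex.normSq_neg, neg_sub]
    simp only [map_mul, ← mul_assoc, hsw] at h2
    rw [sub_right_comm] at h2
    refine ⟨?_, h2⟩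
    filter_upwards [h1] with z hz
    rw [mul_assoc, ← hsw, ← map_mul]
    exact mul_ne_zero four_ne_zero (Complex.normSq_pos.mpr hz).ne'

section surface

variable {L : PeriodPair} {p : ℂ} {φ ψ h : ℂ → ℂ} {X : Torus L → Fin 4 → ℝ}

lemma IsElliptic.meromorphic {f : ℂ → ℂ} (hf : IsElliptic L f) : Meromorphic f :=
  fun z => (hf.meromorphicNF (Set.mem_univ z)).meromorphicAt

/-- The coefficient functions of the Weierstrass form before removing singularities. -/
def rawForm (φ ψ h : ℂ → ℂ) (j : Fin 4) (w : ℂ) : ℂ :=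
  (![φ w + ψ w, -Complex.I * (φ w - ψ w), 1 - φ w * ψ w, 1 + φ w * ψ w] : Fin 4 → ℂ) j * h w

lemma meromorphic_rawForm (hφ : Meromorphic φ) (hψ : Meromorphic ψ) (hh : Meromorphic h)
    (j : Fin 4) : Meromorphic (rawForm φ ψ h j) := by
  intro z
  have h1 := hφ z
  have h2 := hψ z
  have h3 := hh z
  unfold rawForm
  fin_cases j
  · exact (h1.add h2).mul h3
  · exact ((MeromorphicAt.const (-Complex.I) z).mul (h1.sub h2)).mul h3
  · exact ((MeromorphicAt.const 1 z).sub (h1.mul h2)).mul h3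
  · exact ((MeromorphicAt.const 1 z).add (h1.mul h2)).mul h3

lemma weierstrassForm_eq (φ ψ h : ℂ → ℂ) (z : ℂ) (j : Fin 4) :
    weierstrassForm φ ψ h z j = normalForm (rawForm φ ψ h j) z := rfl

lemma eventually_codiscrete_sub_notMem (L : PeriodPair) (p : ℂ) :
    ∀ᶠ z in codiscrete ℂ, z - p ∉ L.lattice :=
  eventually_codiscrete_iff.mpr (eventually_nhdsNE_sub_notMem L p)

lemma confFactor_eventuallyEq (hX : IsCompleteRegularAlgebraic L p φ ψ h X) :
    confFactor X =ᶠ[codiscrete ℂ] fun z =>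
      4 * Complex.normSq (φ z - starRingEnd ℂ (ψ z)) * Complex.normSq (h z) := by
  have hj : ∀ᶠ z in codiscrete ℂ, ∀ j, normalForm (rawForm φ ψ h j) z = rawForm φ ψ h j z :=
    eventually_all.mpr fun j => normalForm_eventuallyEq (meromorphic_rawForm
      hX.elliptic_left.meromorphic hX.elliptic_right.meromorphic hX.elliptic_height.meromorphic j)
  filter_upwards [hj, eventually_codiscrete_sub_notMem L p] with z h1 h2
  have := firstFundamentalForm X z (φ z) (ψ z) (h z) 1 (fun j => by
    rw [hX.representation z (proj_mem_punctured_iff.mpr h2), weierstrassForm_eq, h1]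
    rfl)
  rw [map_one Complex.normSq, mul_one] at this
  exact this

lemma half_sub_notMem (L : PeriodPair) (p : ℂ) : p + L.ω₁ / 2 - p ∉ L.lattice := by
  rw [add_sub_cancel_left]
  exact L.ω₁_div_two_notMem_lattice

/-- The height differential is not identically zero, so its order at the puncture is finite. -/
lemma exists_order_height (hX : IsCompleteRegularAlgebraic L p φ ψ h X) :
    ∃ m : ℤ, meromorphicOrderAt h p = m := by
  have h1 := hX.zeros_height (p + L.ω₁ / 2) (proj_mem_punctured_iff.mpr (half_sub_notMem L p))
  have : meromorphicOrderAt h p ≠ ⊤ :=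
    MeromorphicOn.meromorphicOrderAt_ne_top_of_isPreconnected
      (fun z _ => hX.elliptic_height.meromorphic z)
      isPreconnected_univ (Set.mem_univ (p + L.ω₁ / 2)) (Set.mem_univ p) (by
        rw [h1]; exact WithTop.coe_ne_top)
  exact ⟨_, (WithTop.coe_untop₀_of_ne_top this).symm⟩

/-- The total curvature is determined by the order at the puncture of the conformal factor: if the
metric is `|z - p|^(2e)` times a smooth positive factor near `p`, then `∫ K dM = 2π e`. -/
theorem totalCurvature_eq (hX : IsCompleteRegularAlgebraic L p φ ψ h X) {m : ℤ}
    (hm : meromorphicOrderAt h p = m) :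
    totalCurvature X = 2 * Real.pi * (m - poleOrder φ p - poleOrder ψ p : ℤ) := by
  have hE := confFactor_eventuallyEq hX
  have hNFφ : ∀ z, MeromorphicNFAt φ z := fun z => hX.elliptic_left.meromorphicNF (Set.mem_univ z)
  have hNFψ : ∀ z, MeromorphicNFAt ψ z :=
    fun z => hX.elliptic_right.meromorphicNF (Set.mem_univ z)
  have hmer := hX.elliptic_height.meromorphic
  -- At points of the surface the order of `h` balances the poles of `φ` and `ψ`, so that the
  -- conformal factor has a logarithm that extends smoothly.
  have hord : ∀ z, ∃ k : ℤ, meromorphicOrderAt h z = k ∧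
      (z - p ∉ L.lattice → k - poleOrder φ z - poleOrder ψ z = 0) := by
    intro z
    by_cases hz : z - p ∈ L.lattice
    · refine ⟨m, ?_, fun h => absurd hz h⟩
      have := Periodic.meromorphicOrderAt hX.elliptic_height.periodic _ hz p
      rwa [add_sub_cancel, hm] at this
    · refine ⟨_, hX.zeros_height z (proj_mem_punctured_iff.mpr hz), fun _ => ?_⟩
      push_cast
      ring
  have hUE : ∀ z, (fun z => Real.log (confFactor X z)) =ᶠ[𝓝[≠] z] fun z =>
      Real.log (4 * Complex.normSq (φ z - starRingEnd ℂ (ψ z)) * Complex.normSq (h z)) :=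
    fun z => (eventually_codiscrete_iff.mp hE z).mono fun w hw => by simp only [hw]
  have hE0 : ∀ᵐ z : ℂ, confFactor X z ≠ 0 := by
    refine ae_of_eventually_nhdsNE fun z => ?_
    obtain ⟨k, hk, -⟩ := hord z
    filter_upwards [eventually_codiscrete_iff.mp hE z, (exists_log_confFactor_expansion (hNFφ z)
      (hNFψ z) (hmer z) hk (hX.regular z)).1] with w h1 h2
    rwa [h1]
  have key := integral_laplacian_of_log_singularity (L := L) (p := p)
    (U := fun z => Real.log (confFactor X z))
    (n := 2 * (m - poleOrder φ p - poleOrder ψ p : ℤ))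
    (fun l hl z => by simp only [periodic_confFactor X l hl z])
    (fun z hz => by
      obtain ⟨k, hk, hk0⟩ := hord z
      obtain ⟨s, hs, hse⟩ := (exists_log_confFactor_expansion (hNFφ z)
        (hNFψ z) (hmer z) hk (hX.regular z)).2
      refine ⟨s, hs, (hUE z).trans (hse.trans ?_)⟩
      rw [hk0 hz]
      exact Eventually.of_forall fun w => by simp)
    (by
      obtain ⟨s, hs, hse⟩ := (exists_log_confFactor_expansion (hNFφ p)
        (hNFψ p) (hmer p) hm (hX.regular p)).2
      exact ⟨s, hs, (hUE p).trans hse⟩)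
  have hint : totalCurvature X = ∫ z in cell L,
      -(1 / 2) * Laplacian.laplacian (fun z => Real.log (confFactor X z)) z := by
    refine integral_congr_ae (ae_restrict_of_ae ?_)
    filter_upwards [hE0] with z hz
    simp only [gaussCurvature]
    field_simp
  rw [hint, integral_const_mul, key]
  ring

end surface

/-! ### Symmetry of the Weierstrass data and of the surface -/

lemma neg_poleOrder_le (f : ℂ → ℂ) (z : ℂ) :
    ((-(poleOrder f z : ℤ) : ℤ) : WithTop ℤ) ≤ meromorphicOrderAt f z := by
  by_cases h : meromorphicOrderAt f z < 0
  · exact (order_eq_neg_poleOrder h).2.ge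
  · rw [poleOrder_of_nonneg (not_lt.mp h)]
    simpa using h

lemma order_const_nonneg (c z : ℂ) : 0 ≤ meromorphicOrderAt (fun _ : ℂ => c) z :=
  analyticAt_const.meromorphicOrderAt_nonneg

lemma neg_poleOrder_le_sub_const {f : ℂ → ℂ} {z : ℂ} (hf : MeromorphicAt f z) (c : ℂ) :
    ((-(poleOrder f z : ℤ) : ℤ) : WithTop ℤ) ≤ meromorphicOrderAt (fun w => f w - c) z := by
  have e : (fun w => f w - c) = f + fun _ => -c := by
    ext w; simp [sub_eq_add_neg]
  rw [e]
  refine le_trans (le_min (neg_poleOrder_le f z) ?_)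
    (meromorphicOrderAt_add hf analyticAt_const.meromorphicAt)
  refine le_trans ?_ (order_const_nonneg (-c) z)
  rw [← WithTop.coe_zero, WithTop.coe_le_coe]
  omega

lemma order_sub_of_multiplicity {f : ℂ → ℂ} {p : ℂ} (h : multiplicityAt f p = 2)
    (h0 : ¬ meromorphicOrderAt f p < 0) :
    meromorphicOrderAt (fun w => f w - f p) p = ((2 : ℤ) : WithTop ℤ) := by
  simp only [multiplicityAt, if_neg h0] at h
  cases hn : meromorphicOrderAt (fun w => f w - f p) p with
  | top => simp [hn] at h
  | coe n =>
    rw [hn, WithTop.untop₀_coe] at h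
    rw [WithTop.coe_inj]
    omega

lemma poleOrder_of_multiplicity {f : ℂ → ℂ} {p : ℂ} (h : multiplicityAt f p = 2)
    (h0 : meromorphicOrderAt f p < 0) : poleOrder f p = 2 := by
  simpa only [multiplicityAt, if_pos h0] using h

/-- Evenness about `p`. The identity is required off a discrete set only, so that products of
elliptic functions, whose values at poles are placeholders, can be even. -/
def EvenAbout (p : ℂ) (f : ℂ → ℂ) : Prop := (fun z => f (2 * p - z)) =ᶠ[codiscrete ℂ] f

/-- An elliptic function that has no poles, and no zero at `p`, is a nonzero constant. -/
lemma exists_ne_zero_const {L : PeriodPair} {p : ℂ} {f : ℂ → ℂ} (hf : Meromorphic f)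
    (hp : Periodic L f) (h0 : ∀ z, z - p ∉ L.lattice → 0 ≤ meromorphicOrderAt f z)
    (hord : meromorphicOrderAt f p = ((0 : ℤ) : WithTop ℤ)) :
    ∃ c, c ≠ 0 ∧ f =ᶠ[codiscrete ℂ] fun _ => c := by
  have hnn : ∀ z, 0 ≤ meromorphicOrderAt f z := by
    intro z
    by_cases hz : z - p ∈ L.lattice
    · have := hp.meromorphicOrderAt _ hz p
      rw [add_sub_cancel] at this
      rw [this, hord, WithTop.coe_zero]
    · exact h0 z hz
  obtain ⟨c, hc⟩ := eventuallyEq_const_of_order_nonneg hf hp hnn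
  refine ⟨c, ?_, hc⟩
  rintro rfl
  rw [meromorphicOrderAt_eq_top_iff.mpr (eventually_codiscrete_iff.mp hc p)] at hord
  exact WithTop.top_ne_coe hord

section

variable {L : PeriodPair} {p : ℂ} {φ ψ h : ℂ → ℂ}

/-- If `φ` and `ψ` are finite at `p` with multiplicity two and `h` has a pole of order four there,
the products of `h` with `φ - φ p` and `ψ - ψ p` have a pole of order two, and the product with
both is a nonzero constant. -/
lemma even_of_finite (hφ : Meromorphic φ) (hψ : Meromorphic ψ) (hh : Meromorphic h)
    (pφ : Periodic L φ) (pψ : Periodic L ψ) (ph : Periodic L h)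
    (hzero : ∀ z, z - p ∉ L.lattice →
      meromorphicOrderAt h z = (((poleOrder φ z + poleOrder ψ z : ℕ) : ℤ) : WithTop ℤ))
    {a b : ℂ} (ha : meromorphicOrderAt (fun w => φ w - a) p = ((2 : ℤ) : WithTop ℤ))
    (hb : meromorphicOrderAt (fun w => ψ w - b) p = ((2 : ℤ) : WithTop ℤ))
    (hord : meromorphicOrderAt h p = ((-4 : ℤ) : WithTop ℤ)) :
    EvenAbout p h ∧ EvenAbout p (fun z => φ z * h z) ∧ EvenAbout p (fun z => ψ z * h z) ∧
      EvenAbout p (fun z => φ z * ψ z * h z) := by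
  have mφ : Meromorphic fun w => φ w - a := fun z => (hφ z).sub (MeromorphicAt.const a z)
  have mψ : Meromorphic fun w => ψ w - b := fun z => (hψ z).sub (MeromorphicAt.const b z)
  have mB : Meromorphic fun w => (φ w - a) * h w := fun z => (mφ z).mul (hh z)
  have mC : Meromorphic fun w => (ψ w - b) * h w := fun z => (mψ z).mul (hh z)
  have mD : Meromorphic fun w => (φ w - a) * ((ψ w - b) * h w) := fun z => (mφ z).mul (mC z)
  have oB : ∀ z, meromorphicOrderAt (fun w => (φ w - a) * h w) z =
      meromorphicOrderAt (fun w => φ w - a) z + meromorphicOrderAt h z :=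
    fun z => meromorphicOrderAt_mul (mφ z) (hh z)
  have oC : ∀ z, meromorphicOrderAt (fun w => (ψ w - b) * h w) z =
      meromorphicOrderAt (fun w => ψ w - b) z + meromorphicOrderAt h z :=
    fun z => meromorphicOrderAt_mul (mψ z) (hh z)
  have oD : ∀ z, meromorphicOrderAt (fun w => (φ w - a) * ((ψ w - b) * h w)) z =
      meromorphicOrderAt (fun w => φ w - a) z +
        (meromorphicOrderAt (fun w => ψ w - b) z + meromorphicOrderAt h z) :=
    fun z => by rw [← oC]; exact meromorphicOrderAt_mul (mφ z) (mC z)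
  have eB : EvenAbout p fun w => (φ w - a) * h w := by
    refine even_of_order_ge_neg_two (L := L) mB (fun l hl z => by simp only [pφ l hl z, ph l hl z])
      (fun z hz => ?_) ?_
    · rw [oB, hzero z hz]
      refine le_trans ?_ (add_le_add_left (neg_poleOrder_le_sub_const (hφ z) a) _)
      rw [← WithTop.coe_add, ← WithTop.coe_zero, WithTop.coe_le_coe]
      push_cast
      omega
    · rw [oB, ha, hord, ← WithTop.coe_add, WithTop.coe_le_coe]
      norm_num
  have eC : EvenAbout p fun w => (ψ w - b) * h w := by
    refine even_of_order_ge_neg_two (L := L) mC (fun l hl z => by simp only [pψ l hl z, ph l hl z])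
      (fun z hz => ?_) ?_
    · rw [oC, hzero z hz]
      refine le_trans ?_ (add_le_add_left (neg_poleOrder_le_sub_const (hψ z) b) _)
      rw [← WithTop.coe_add, ← WithTop.coe_zero, WithTop.coe_le_coe]
      push_cast
      omega
    · rw [oC, hb, hord, ← WithTop.coe_add, WithTop.coe_le_coe]
      norm_num
  obtain ⟨k, hk0, hk⟩ := exists_ne_zero_const (L := L) (p := p) mD
    (fun l hl z => by simp only [pφ l hl z, pψ l hl z, ph l hl z])
    (fun z hz => by
      rw [oD, hzero z hz]
      refine le_trans ?_ (add_le_add (neg_poleOrder_le_sub_const (hφ z) a)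
        (add_le_add_left (neg_poleOrder_le_sub_const (hψ z) b) _))
      rw [← WithTop.coe_add, ← WithTop.coe_add, ← WithTop.coe_zero, WithTop.coe_le_coe]
      push_cast
      omega)
    (by
      rw [oD, ha, hb, hord, ← WithTop.coe_add, ← WithTop.coe_add]
      norm_num)
  have hk' := hk.comp_tendsto (tendsto_codiscrete_reflect (2 * p))
  have key : ∀ᶠ z in codiscrete ℂ, h (2 * p - z) = h z ∧
      φ (2 * p - z) * h (2 * p - z) = φ z * h z ∧ ψ (2 * p - z) * h (2 * p - z) = ψ z * h z ∧
      φ (2 * p - z) * ψ (2 * p - z) * h (2 * p - z) = φ z * ψ z * h z := by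
    filter_upwards [eB, eC, hk, hk'] with z h1 h2 h3 h4
    simp only [Function.comp_apply] at h4
    have e1 : h (2 * p - z) = h z := by
      -- `k h` is the product of the two even functions.
      have : k * h (2 * p - z) = k * h z := by
        nth_rewrite 1 [← h4]
        rw [← h3]
        linear_combination (ψ (2 * p - z) - b) * h (2 * p - z) * h1 + (φ z - a) * h z * h2
      exact mul_left_cancel₀ hk0 this
    have e2 : φ (2 * p - z) * h (2 * p - z) = φ z * h z := by linear_combination h1 + a * e1
    have e3 : ψ (2 * p - z) * h (2 * p - z) = ψ z * h z := by linear_combination h2 + b * e1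
    refine ⟨e1, e2, e3, ?_⟩
    linear_combination h4 - h3 + a * e3 + b * e2 - a * b * e1
  exact ⟨key.mono fun z hz => hz.1, key.mono fun z hz => hz.2.1, key.mono fun z hz => hz.2.2.1,
    key.mono fun z hz => hz.2.2.2⟩

/-- If `φ` has a double pole at `p`, `ψ` is finite there with multiplicity two and `h` has a pole of
order two, the product of `h` with `ψ - ψ p` is a nonzero constant. -/
lemma even_of_pole (hφ : Meromorphic φ) (hψ : Meromorphic ψ) (hh : Meromorphic h)
    (pφ : Periodic L φ) (pψ : Periodic L ψ) (ph : Periodic L h)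
    (hzero : ∀ z, z - p ∉ L.lattice →
      meromorphicOrderAt h z = (((poleOrder φ z + poleOrder ψ z : ℕ) : ℤ) : WithTop ℤ))
    {b : ℂ} (ha : meromorphicOrderAt φ p = ((-2 : ℤ) : WithTop ℤ))
    (hb : meromorphicOrderAt (fun w => ψ w - b) p = ((2 : ℤ) : WithTop ℤ))
    (hord : meromorphicOrderAt h p = ((-2 : ℤ) : WithTop ℤ)) :
    EvenAbout p h ∧ EvenAbout p (fun z => φ z * h z) ∧ EvenAbout p (fun z => ψ z * h z) ∧
      EvenAbout p (fun z => φ z * ψ z * h z) := by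
  have mψ : Meromorphic fun w => ψ w - b := fun z => (hψ z).sub (MeromorphicAt.const b z)
  have mC : Meromorphic fun w => (ψ w - b) * h w := fun z => (mψ z).mul (hh z)
  have mD : Meromorphic fun w => φ w * ((ψ w - b) * h w) := fun z => (hφ z).mul (mC z)
  have oC : ∀ z, meromorphicOrderAt (fun w => (ψ w - b) * h w) z =
      meromorphicOrderAt (fun w => ψ w - b) z + meromorphicOrderAt h z :=
    fun z => meromorphicOrderAt_mul (mψ z) (hh z)
  have oD : ∀ z, meromorphicOrderAt (fun w => φ w * ((ψ w - b) * h w)) z =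
      meromorphicOrderAt φ z +
        (meromorphicOrderAt (fun w => ψ w - b) z + meromorphicOrderAt h z) :=
    fun z => by rw [← oC]; exact meromorphicOrderAt_mul (hφ z) (mC z)
  have eh : EvenAbout p h := by
    refine even_of_order_ge_neg_two (L := L) hh ph (fun z hz => ?_) hord.ge
    rw [hzero z hz, ← WithTop.coe_zero, WithTop.coe_le_coe]
    omega
  have eD : EvenAbout p fun w => φ w * ((ψ w - b) * h w) := by
    refine even_of_order_ge_neg_two (L := L) mD
      (fun l hl z => by simp only [pφ l hl z, pψ l hl z, ph l hl z]) (fun z hz => ?_) ?_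
    · rw [oD, hzero z hz]
      refine le_trans ?_ (add_le_add (neg_poleOrder_le φ z)
        (add_le_add_left (neg_poleOrder_le_sub_const (hψ z) b) _))
      rw [← WithTop.coe_add, ← WithTop.coe_add, ← WithTop.coe_zero, WithTop.coe_le_coe]
      push_cast
      omega
    · rw [oD, ha, hb, hord, ← WithTop.coe_add, ← WithTop.coe_add, WithTop.coe_le_coe]
      norm_num
  obtain ⟨k, hk0, hk⟩ := exists_ne_zero_const (L := L) (p := p) mC
    (fun l hl z => by simp only [pψ l hl z, ph l hl z])
    (fun z hz => by
      rw [oC, hzero z hz]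
      refine le_trans ?_ (add_le_add_left (neg_poleOrder_le_sub_const (hψ z) b) _)
      rw [← WithTop.coe_add, ← WithTop.coe_zero, WithTop.coe_le_coe]
      push_cast
      omega)
    (by
      rw [oC, hb, hord, ← WithTop.coe_add]
      norm_num)
  have hk' := hk.comp_tendsto (tendsto_codiscrete_reflect (2 * p))
  have key : ∀ᶠ z in codiscrete ℂ,
      φ (2 * p - z) * h (2 * p - z) = φ z * h z ∧ ψ (2 * p - z) * h (2 * p - z) = ψ z * h z ∧
      φ (2 * p - z) * ψ (2 * p - z) * h (2 * p - z) = φ z * ψ z * h z := by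
    filter_upwards [eh, eD, hk, hk'] with z h1 h2 h3 h4
    simp only [Function.comp_apply] at h4
    have e2 : φ (2 * p - z) * h (2 * p - z) = φ z * h z := by
      have : k * (φ (2 * p - z) * h (2 * p - z)) = k * (φ z * h z) := by
        nth_rewrite 1 [← h4]
        rw [← h3]
        linear_combination h (2 * p - z) * h2 + φ z * ((ψ z - b) * h z) * h1
      exact mul_left_cancel₀ hk0 this
    refine ⟨e2, ?_, ?_⟩
    · linear_combination h4 - h3 + b * h1
    · linear_combination h2 + b * e2
  exact ⟨eh, key.mono fun z hz => hz.1, key.mono fun z hz => hz.2.1, key.mono fun z hz => hz.2.2⟩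

end

section surface

variable {L : PeriodPair} {p : ℂ} {φ ψ h : ℂ → ℂ} {X : Torus L → Fin 4 → ℝ}

/-- The four products from which the Weierstrass form is built are even about the puncture. The total
curvature enters only through the order of `h` at `p`. -/
theorem even_products (hX : IsCompleteRegularAlgebraic L p φ ψ h X)
    (hcurv : -totalCurvature X = 8 * Real.pi) (hφ : multiplicityAt φ p = 2)
    (hψ : multiplicityAt ψ p = 2) :
    EvenAbout p h ∧ EvenAbout p (fun z => φ z * h z) ∧ EvenAbout p (fun z => ψ z * h z) ∧
      EvenAbout p (fun z => φ z * ψ z * h z) := by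
  obtain ⟨m, hm⟩ := exists_order_height hX
  have hm4 : m = -4 + poleOrder φ p + poleOrder ψ p := by
    rw [totalCurvature_eq hX hm] at hcurv
    have h1 : ((m - poleOrder φ p - poleOrder ψ p : ℤ) : ℝ) = ((-4 : ℤ) : ℝ) := by
      refine mul_left_cancel₀ (two_ne_zero (α := ℝ)) (mul_left_cancel₀ Real.pi_ne_zero ?_)
      push_cast at hcurv ⊢
      linarith
    have := Int.cast_injective h1
    omega
  have mφ := hX.elliptic_left.meromorphic
  have mψ := hX.elliptic_right.meromorphic
  have mh := hX.elliptic_height.meromorphic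
  have pφ := hX.elliptic_left.periodic
  have pψ := hX.elliptic_right.periodic
  have ph := hX.elliptic_height.periodic
  have hzero := fun z hz => hX.zeros_height z (proj_mem_punctured_iff.mpr hz)
  have hne := hX.regular p
  by_cases cφ : meromorphicOrderAt φ p < 0
  · have cψ := not_both_poles hne cφ
    rw [poleOrder_of_multiplicity hφ cφ, poleOrder_of_nonneg cψ] at hm4
    have hφo := (order_eq_neg_poleOrder cφ).2
    rw [poleOrder_of_multiplicity hφ cφ] at hφo
    exact even_of_pole mφ mψ mh pφ pψ ph hzero hφo
      (order_sub_of_multiplicity hψ (not_lt.mpr cψ)) (by rw [hm, hm4]; norm_num)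
  · by_cases cψ : meromorphicOrderAt ψ p < 0
    · rw [poleOrder_of_multiplicity hψ cψ, poleOrder_of_nonneg (not_lt.mp cφ)] at hm4
      have hψo := (order_eq_neg_poleOrder cψ).2
      rw [poleOrder_of_multiplicity hψ cψ] at hψo
      obtain ⟨h1, h2, h3, h4⟩ := even_of_pole mψ mφ mh pψ pφ ph
        (fun z hz => by rw [hzero z hz, add_comm]) hψo
        (order_sub_of_multiplicity hφ cφ) (by rw [hm, hm4]; norm_num)
      simp only [mul_comm (ψ _) (φ _)] at h4
      exact ⟨h1, h3, h2, h4⟩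
    · rw [poleOrder_of_nonneg (not_lt.mp cψ), poleOrder_of_nonneg (not_lt.mp cφ)] at hm4
      exact even_of_finite mφ mψ mh pφ pψ ph hzero (order_sub_of_multiplicity hφ cφ)
        (order_sub_of_multiplicity hψ cψ) (by rw [hm, hm4]; norm_num)

lemma weierstrassForm_reflect (hX : IsCompleteRegularAlgebraic L p φ ψ h X)
    (hcurv : -totalCurvature X = 8 * Real.pi) (hφ : multiplicityAt φ p = 2)
    (hψ : multiplicityAt ψ p = 2) (z : ℂ) :
    weierstrassForm φ ψ h (2 * p - z) = weierstrassForm φ ψ h z := by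
  obtain ⟨h1, h2, h3, h4⟩ := even_products hX hcurv hφ hψ
  ext j
  rw [weierstrassForm_eq, weierstrassForm_eq]
  have hm := meromorphic_rawForm hX.elliptic_left.meromorphic hX.elliptic_right.meromorphic
    hX.elliptic_height.meromorphic j
  refine congrFun (eq_of_meromorphicNF (f := fun z => normalForm (rawForm φ ψ h j) (2 * p - z))
    (fun z => (meromorphicNFAt_normalForm _ (2 * p - z)).comp_analyticAt
      (g := fun w => 2 * p - w) (by fun_prop)) (meromorphicNFAt_normalForm _) ?_) z
  have e1 := normalForm_eventuallyEq hm
  have e2 := e1.comp_tendsto (tendsto_codiscrete_reflect (2 * p))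
  filter_upwards [e1, e2, h1, h2, h3, h4] with w w1 w2 w3 w4 w5 w6
  simp only [Function.comp_apply] at w2
  rw [w1, w2]
  fin_cases j
  · simp [rawForm]
    linear_combination w4 + w5
  · simp [rawForm]
    linear_combination Complex.I * (w4 - w5)
  · simp [rawForm]
    linear_combination w3 - w6
  · simp [rawForm]
    linear_combination w3 + w6

lemma reflect_sub_notMem {z : ℂ} (hz : z - p ∉ L.lattice) : 2 * p - z - p ∉ L.lattice := by
  intro h
  have := neg_mem h
  exact hz (by convert this using 1; ring)

lemma wirtinger_reflect (hX : IsCompleteRegularAlgebraic L p φ ψ h X)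
    (hcurv : -totalCurvature X = 8 * Real.pi) (hφ : multiplicityAt φ p = 2)
    (hψ : multiplicityAt ψ p = 2) {z : ℂ} (hz : z - p ∉ L.lattice) :
    wirtinger X (2 * p - z) = wirtinger X z := by
  rw [hX.representation _ (proj_mem_punctured_iff.mpr hz),
    hX.representation _ (proj_mem_punctured_iff.mpr (reflect_sub_notMem hz)),
    weierstrassForm_reflect hX hcurv hφ hψ]

lemma fderiv_lift_eq (X : Torus L → Fin 4 → ℝ) (z v : ℂ) (j : Fin 4) :
    fderiv ℝ (lift X) z v j = 2 * (v.re * (wirtinger X z j).re - v.im * (wirtinger X z j).im) := by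
  have hv : v = v.re • (1 : ℂ) + v.im • Complex.I := by
    apply Complex.ext <;> simp
  have e : fderiv ℝ (lift X) z v =
      v.re • fderiv ℝ (lift X) z 1 + v.im • fderiv ℝ (lift X) z Complex.I := by
    conv_lhs => rw [hv]
    rw [map_add, map_smul, map_smul]
  rw [e]
  simp [wirtinger]
  ring

lemma isOpen_sub_notMem (L : PeriodPair) (p : ℂ) : IsOpen {z : ℂ | z - p ∉ L.lattice} :=
  L.isClosed_lattice.isOpen_compl.preimage (continuous_id.sub continuous_const)

lemma isPreconnected_sub_notMem (L : PeriodPair) (p : ℂ) :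
    IsPreconnected {z : ℂ | z - p ∉ L.lattice} := by
  have hc : Countable L.lattice := inferInstance
  have h1 : ({z : ℂ | z - p ∈ L.lattice}).Countable :=
    (Set.countable_coe_iff.mp hc : (L.lattice : Set ℂ).Countable).preimage
      (sub_left_injective (b := p))
  exact (h1.isPathConnected_compl_of_one_lt_rank
    (by rw [Complex.rank_real_complex]; exact Cardinal.one_lt_two)).isConnected.isPreconnected

/-- The sum of the surface and its reflection is constant: its differential vanishes, and the
punctured plane is connected. -/
theorem exists_lift_add_reflect (hX : IsCompleteRegularAlgebraic L p φ ψ h X)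
    (hcurv : -totalCurvature X = 8 * Real.pi) (hφ : multiplicityAt φ p = 2)
    (hψ : multiplicityAt ψ p = 2) :
    ∃ c : Fin 4 → ℝ, ∀ z, z - p ∉ L.lattice → lift X z + lift X (2 * p - z) = c := by
  have hd : ∀ z, z - p ∉ L.lattice →
      HasFDerivAt (fun z => lift X z + lift X (2 * p - z)) (0 : ℂ →L[ℝ] Fin 4 → ℝ) z := by
    intro z hz
    have d1 := (hX.differentiable z (proj_mem_punctured_iff.mpr hz)).hasFDerivAt
    have d2 := (hX.differentiable _
      (proj_mem_punctured_iff.mpr (reflect_sub_notMem hz))).hasFDerivAt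
    have d3 : HasFDerivAt (fun w : ℂ => 2 * p - w) (-(ContinuousLinearMap.id ℝ ℂ)) z :=
      (hasFDerivAt_id z).const_sub (2 * p)
    refine (d1.add (d2.comp z d3)).congr_fderiv ?_
    ext1 v
    ext j
    simp [fderiv_lift_eq, wirtinger_reflect hX hcurv hφ hψ hz]
  obtain ⟨c, hc⟩ := (isOpen_sub_notMem L p).exists_is_const_of_fderiv_eq_zero
    (isPreconnected_sub_notMem L p)
    (fun z hz => (hd z hz).differentiableAt.differentiableWithinAt)
    (fun z hz => (hd z hz).fderiv)
  exact ⟨c, hc⟩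

end surface

/-! ### The fixed points of the involution -/

/-- Lifts to `ℂ` of the fixed points of the involution other than the puncture: `p` plus the three
nonzero half periods. -/
noncomputable def halfPoint (L : PeriodPair) (p : ℂ) : Fin 3 → ℂ :=
  ![p + L.ω₁ / 2, p + L.ω₂ / 2, p + (L.ω₁ + L.ω₂) / 2]

lemma involution_proj (L : PeriodPair) (p z : ℂ) :
    involution L p (proj L z) = proj L (2 * p - z) := rfl

lemma proj_surjective (L : PeriodPair) (t : Torus L) : ∃ z, proj L z = t :=
  Submodule.Quotient.mk_surjective _ t

lemma injective_proj_halfPoint (L : PeriodPair) (p : ℂ) :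
    Function.Injective fun i => proj L (halfPoint L p i) := by
  have h12 : L.ω₁ / 2 - L.ω₂ / 2 ∉ L.lattice := by
    have := (L.mul_ω₁_add_mul_ω₂_mem_lattice (α := 1 / 2) (β := -1 / 2)).not.mpr (by norm_num)
    intro h
    apply this
    convert h using 1
    push_cast
    ring
  have h1 := L.ω₁_div_two_notMem_lattice
  have h2 := L.ω₂_div_two_notMem_lattice
  have key : ∀ i j : Fin 3, i < j → proj L (halfPoint L p i) ≠ proj L (halfPoint L p j) := by
    intro i j hij he
    have hm := proj_eq_proj_iff.mp he
    have hm' := neg_mem hm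
    fin_cases i <;> fin_cases j <;> simp [halfPoint] at hij hm hm'
    · exact h12 (by convert hm using 1)
    · exact h2 (by convert hm' using 1; ring)
    · exact h1 (by convert hm' using 1; ring)
  intro i j hij
  rcases lt_trichotomy i j with h | h | h
  · exact absurd hij (key i j h)
  · exact h
  · exact absurd hij.symm (key j i h)

lemma fixedPoints_eq_range (L : PeriodPair) (p : ℂ) :
    {t | t ∈ punctured L p ∧ involution L p t = t} =
      Set.range fun i => proj L (halfPoint L p i) := by
  ext t
  constructor
  · rintro ⟨ht, hfix⟩
    obtain ⟨z, rfl⟩ := proj_surjective L t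
    rw [proj_mem_punctured_iff] at ht
    rw [involution_proj, proj_eq_proj_iff] at hfix
    obtain ⟨m, n, hmn⟩ := PeriodPair.mem_lattice.mp (neg_mem hfix)
    have hz : z - p = m * L.ω₁ / 2 + n * L.ω₂ / 2 := by linear_combination -hmn / 2
    have hmem : ∀ k l : ℤ, (k : ℂ) * L.ω₁ + l * L.ω₂ ∈ L.lattice := fun k l =>
      PeriodPair.mem_lattice.mpr ⟨k, l, rfl⟩
    obtain ⟨k, hk⟩ := Int.even_or_odd' m
    obtain ⟨l, hl⟩ := Int.even_or_odd' n
    rcases hk with rfl | rfl <;> rcases hl with rfl | rfl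
    · refine absurd ?_ ht
      convert hmem k l using 1
      rw [hz]; push_cast; ring
    · refine ⟨1, (proj_eq_proj_iff.mpr ?_).symm⟩
      convert hmem k l using 1
      simp only [halfPoint]
      push_cast at hz
      simp
      linear_combination hz
    · refine ⟨0, (proj_eq_proj_iff.mpr ?_).symm⟩
      convert hmem k l using 1
      simp only [halfPoint]
      push_cast at hz
      simp
      linear_combination hz
    · refine ⟨2, (proj_eq_proj_iff.mpr ?_).symm⟩
      convert hmem k l using 1
      simp only [halfPoint]
      push_cast at hz
      simp
      linear_combination hz
  · rintro ⟨i, rfl⟩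
    refine ⟨proj_mem_punctured_iff.mpr ?_, ?_⟩
    · fin_cases i
      · simpa [halfPoint] using L.ω₁_div_two_notMem_lattice
      · simpa [halfPoint] using L.ω₂_div_two_notMem_lattice
      · simpa [halfPoint] using add_half_notMem_lattice L
    · beta_reduce
      rw [involution_proj, proj_eq_proj_iff]
      have m1 := L.ω₁_mem_lattice
      have m2 := L.ω₂_mem_lattice
      fin_cases i
      · convert neg_mem m1 using 1
        simp [halfPoint]; ring
      · convert neg_mem m2 using 1
        simp [halfPoint]; ring
      · convert neg_mem (add_mem m1 m2) using 1
        simp [halfPoint]; ring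

end StationaryTorus

theorem theorem8p1 (L : PeriodPair) (p : ℂ) (φ ψ h : ℂ → ℂ)
    (X : StationaryTorus.Torus L → Fin 4 → ℝ)
    (hX : StationaryTorus.IsCompleteRegularAlgebraic L p φ ψ h X)
    (hcurv : -StationaryTorus.totalCurvature X = 8 * Real.pi)
    (hφ : StationaryTorus.multiplicityAt φ p = 2)
    (hψ : StationaryTorus.multiplicityAt ψ p = 2) :
    -- the surface is not embedded
    ¬ StationaryTorus.IsEmbeddedSurface p X ∧
    -- the involution is `(x, y) ↦ (x, -y)` in the coordinates `x = ℘(z - p)`, `y = ℘'(z - p)`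
    Function.Involutive (StationaryTorus.involution L p) ∧
    (∀ z, StationaryTorus.involution L p (StationaryTorus.proj L z) =
        StationaryTorus.proj L (2 * p - z) ∧
      L.weierstrassP (2 * p - z - p) = L.weierstrassP (z - p) ∧
      L.derivWeierstrassP (2 * p - z - p) = -L.derivWeierstrassP (z - p)) ∧
    -- its pull-back reverses the sign of `X_z dz`
    (∀ z, StationaryTorus.proj L z ∈ StationaryTorus.punctured L p → ∀ j,
      StationaryTorus.wirtinger X (2 * p - z) j * deriv (fun w => 2 * p - w) z =
        -StationaryTorus.wirtinger X z j) ∧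
    -- its fixed points other than the puncture are three points, with one common image
    ∃ Q : Fin 3 → StationaryTorus.Torus L, Function.Injective Q ∧
      {t | t ∈ StationaryTorus.punctured L p ∧ StationaryTorus.involution L p t = t} =
        Set.range Q ∧
      ∃ c : Fin 4 → ℝ, ∀ i, X (Q i) = c := by
  open StationaryTorus in
  have hfix := fixedPoints_eq_range L p
  have hinj := injective_proj_halfPoint L p
  have hQ : ∀ i, proj L (halfPoint L p i) ∈ punctured L p ∧
      involution L p (proj L (halfPoint L p i)) = proj L (halfPoint L p i) := fun i =>
    hfix.symm.subset (Set.mem_range_self i)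
  have hcommon : ∃ c : Fin 4 → ℝ, ∀ i, X (proj L (halfPoint L p i)) = c := by
    obtain ⟨c, hc⟩ := exists_lift_add_reflect hX hcurv hφ hψ
    refine ⟨(1 / 2 : ℝ) • c, fun i => ?_⟩
    have h1 := hc _ (proj_mem_punctured_iff.mp (hQ i).1)
    simp only [lift] at h1
    rw [← involution_proj, (hQ i).2] at h1
    rw [← h1, ← two_smul ℝ, smul_smul]
    norm_num
  have hrefl : ∀ z : ℂ, 2 * p - z - p = -(z - p) := fun z => by ring
  refine ⟨?_, ?_, ?_, ?_, fun i => proj L (halfPoint L p i), hinj, hfix, hcommon⟩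
  · intro hemb
    obtain ⟨c, hc⟩ := hcommon
    have := hemb.injective (a₁ := ⟨_, (hQ 0).1⟩) (a₂ := ⟨_, (hQ 1).1⟩) ((hc 0).trans (hc 1).symm)
    exact absurd (hinj (Subtype.ext_iff.mp this)) (by decide)
  · intro t
    exact sub_sub_cancel _ _
  · intro z
    rw [hrefl]
    exact ⟨rfl, L.weierstrassP_neg _, L.derivWeierstrassP_neg _⟩
  · intro z hz j
    rw [wirtinger_reflect hX hcurv hφ hψ (proj_mem_punctured_iff.mp hz)]
    simp
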